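/- **Theorem 3.1.** A tournament is a loopless digraph in which, for any two distinct vertices $u,v$, exactly one of $uv$ and $vu$ is an edge. An oriented tree is a finite digraph with at most one edge between any two vertices whose underlying undirected graph is a tree; its leaves are its vertices of degree $1$ in the underlying graph. A bare path of an oriented tree $T$ is a path in the underlying graph of $T$ all of whose internal vertices have degree $2$ in the underlying graph; it is directed if its edges are all oriented from one of its ends towards the other. Let $n,k$ be non-negative integers. Then every tournament with $n+50k$ vertices contains a copy of every oriented tree with $n$ vertices and $k$ leaves in which every bare path is directed; that is, there is an injective map from the vertices of the tree to the vertices of the tournament that maps each edge $uv$ of the tree to an edge of the tournament with the same orientation. -/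

import Mathlib

namespace Digraph

/-- The underlying (undirected, simple) graph of a digraph. -/
abbrev underlying {V : Type*} (D : Digraph V) : SimpleGraph V := D.toSimpleGraphInclusive

/-- An oriented graph: no loops, and at most one edge between any two vertices
(taking `u = v` shows that there are no loops). -/
def IsOrientedGraph {V : Type*} (D : Digraph V) : Prop :=
  ∀ u v : V, D.Adj u v → ¬ D.Adj v u

/-- An oriented tree: an oriented graph whose underlying graph is a tree. -/
def IsOrientedTree {V : Type*} (D : Digraph V) : Prop :=
  D.IsOrientedGraph ∧ D.underlying.IsTree

/-- A tournament: a loopless digraph in which, for any two distinct vertices `u` and `v`,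
exactly one of `uv` and `vu` is an edge. -/
def IsTournament {V : Type*} (D : Digraph V) : Prop :=
  (∀ v : V, ¬ D.Adj v v) ∧ ∀ u v : V, u ≠ v → (D.Adj u v ↔ ¬ D.Adj v u)

/-- The degree of a vertex in the underlying graph (for finite vertex sets). -/
noncomputable def underlyingDegree {V : Type*} (D : Digraph V) (v : V) : ℕ :=
  (D.underlying.neighborSet v).ncard

/-- The leaves: the vertices whose degree in the underlying graph is one. -/
def leaves {V : Type*} (D : Digraph V) : Set V :=
  {v | D.underlyingDegree v = 1}

/-- A bare path: a path (with no condition on the directions of its edges) all of whose internal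
vertices have degree two in the whole digraph. -/
def IsBarePath {V : Type*} (D : Digraph V) {u w : V} (p : D.underlying.Walk u w) : Prop :=
  p.IsPath ∧ ∀ x ∈ p.support, x ≠ u → x ≠ w → D.underlyingDegree x = 2

/-- A directed path: the edges are all directed from the first vertex towards the last one, or all
directed from the last vertex towards the first one. -/
def IsDirectedPath {V : Type*} (D : Digraph V) {u w : V} (p : D.underlying.Walk u w) : Prop :=
  p.IsPath ∧ ((∀ d ∈ p.darts, D.Adj d.fst d.snd) ∨ (∀ d ∈ p.darts, D.Adj d.snd d.fst))

/-- `G` contains a copy of `D`: there is an injection of vertices that maps every edge of `D` to an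
edge of `G`. -/
def ContainsCopy {V W : Type*} (G : Digraph W) (D : Digraph V) : Prop :=
  ∃ f : V → W, Function.Injective f ∧ ∀ u v : V, D.Adj u v → G.Adj (f u) (f v)

end Digraph

/-!
In a median order of a tournament, every vertex has at least half of the vertices of each interval
that starts behind it as out-neighbours, and at least half of each interval that ends in front of it
as in-neighbours. Hence small oriented trees can be embedded sparsely into intervals, vertex by
vertex, and disjoint directed paths from given vertices on the left to given vertices far enough to
the right can be built by a greedy scan from left to right that skips few positions, each path being
completed by a path of length three.

In the tree, the vertices of degree two form runs inside directed paths. Give the vertices levels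
which are constant along the edges, except that they increase by one on each edge that leaves a run
of length at least two. The order is cut into consecutive blocks, one for each level. The vertices
of a level outside these runs are embedded sparsely into the block, and then all runs of the level
are embedded simultaneously as disjoint paths towards the next block. This wastes at most `11`
positions for each run and for each vertex outside the runs. There are at most `2 * k - 2` vertices
of degree other than two and fewer runs than such vertices, so at most `44 * k` positions are
wasted.
-/

open Finset Classical

/-! ### Median orders -/

/-- The edges of the digraph `E` on `{0, …, N - 1}` that go forward when the vertices are arranged
by increasing `key`. -/
noncomputable def forwardPairs (E : ℕ → ℕ → Prop) (N : ℕ) (key : ℕ → ℕ) : Finset (ℕ × ℕ) :=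
  {z ∈ range N ×ˢ range N | E z.1 z.2 ∧ key z.1 < key z.2}

/-- A semicomplete digraph on `ℕ` whose natural order is a median order: on every long enough
initial segment, no other arrangement of the vertices has more forward edges. Finite digraphs are
treated as initial segments of `ℕ`, which makes intervals and distances available as `Finset.Ico`
and subtraction. -/
structure IsMedianOrder (E : ℕ → ℕ → Prop) : Prop where
  total : ∀ a b, a ≠ b → E a b ∨ E b a
  card_forwardPairs_le :
    ∀ᶠ N in Filter.atTop, ∀ key, #(forwardPairs E N key) ≤ #(forwardPairs E N id)

section Existence

variable {W : Type*} (G : Digraph W) {n : ℕ}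

/-- The digraph on `ℕ` whose restriction to `{0, …, n - 1}` is `G`, transported along `e`, and in
which all other edges go forward. It makes a median order of `G` one of `ℕ`. -/
def extendByLT (e : Fin n ≃ W) (a b : ℕ) : Prop :=
  if h : a < n ∧ b < n then G.Adj (e ⟨a, h.1⟩) (e ⟨b, h.2⟩) else a < b

variable {G}

theorem extendByLT_val (e : Fin n ≃ W) (a b : Fin n) :
    extendByLT G e a b ↔ G.Adj (e a) (e b) := by
  simp [extendByLT]

variable (G) in
theorem exists_equiv_card_forward_le [Finite W] :
    ∃ e : Fin (Nat.card W) ≃ W, ∀ key : Fin (Nat.card W) → ℕ,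
      #{z : Fin (Nat.card W) × Fin (Nat.card W) | key z.1 < key z.2 ∧ G.Adj (e z.1) (e z.2)} ≤
        #{z : Fin (Nat.card W) × Fin (Nat.card W) | z.1 < z.2 ∧ G.Adj (e z.1) (e z.2)} := by
  have : Nonempty (Fin (Nat.card W) ≃ W) := ⟨(Finite.equivFin W).symm⟩
  obtain ⟨e, he⟩ := Finite.exists_max fun e : Fin (Nat.card W) ≃ W =>
    #{z : Fin (Nat.card W) × Fin (Nat.card W) | z.1 < z.2 ∧ G.Adj (e z.1) (e z.2)}
  refine ⟨e, fun key => ?_⟩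
  let σ := Tuple.sort key
  refine le_trans (card_le_card_of_injOn (Prod.map σ.symm σ.symm) ?_
    (σ.symm.injective.prodMap σ.symm.injective).injOn) (he (σ.trans e))
  rintro ⟨a, b⟩ hab
  simp only [coe_filter, mem_univ, true_and, Set.mem_ofPred_eq] at hab
  refine mem_coe.2 (mem_filter.2 ⟨mem_univ _, ?_, by simpa using hab.2⟩)
  by_contra! hle
  exact absurd hab.1 (by simpa [σ] using Tuple.monotone_sort key hle)

theorem card_forwardPairs_extendByLT_le {e : Fin n ≃ W}
    (he : ∀ key : Fin n → ℕ, #{z : Fin n × Fin n | key z.1 < key z.2 ∧ G.Adj (e z.1) (e z.2)} ≤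
      #{z : Fin n × Fin n | z.1 < z.2 ∧ G.Adj (e z.1) (e z.2)}) {N : ℕ} (hN : n ≤ N)
    (key : ℕ → ℕ) :
    #(forwardPairs (extendByLT G e) N key) ≤ #(forwardPairs (extendByLT G e) N id) := by
  have low_eq (key : ℕ → ℕ) :
      #{z ∈ forwardPairs (extendByLT G e) N key | z.1 < n ∧ z.2 < n} =
        #{z : Fin n × Fin n | key z.1 < key z.2 ∧ G.Adj (e z.1) (e z.2)} := by
    symm
    refine card_bij (fun z _ => (z.1.val, z.2.val)) (fun z hz => ?_) (fun z _ z' _ h => ?_)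
      (fun z hz => ?_)
    · simp only [mem_filter, mem_univ, true_and] at hz
      simp only [forwardPairs, mem_filter, mem_product, mem_range, extendByLT_val]
      exact ⟨⟨⟨by omega, by omega⟩, hz.2, hz.1⟩, by omega, by omega⟩
    · simpa only [Prod.ext_iff, Fin.ext_iff] using h
    · simp only [forwardPairs, mem_filter] at hz
      obtain ⟨⟨-, hE, hkey⟩, h₁, h₂⟩ := hz
      refine ⟨(⟨z.1, h₁⟩, ⟨z.2, h₂⟩), ?_, rfl⟩
      simpa only [mem_filter, mem_univ, true_and, ← extendByLT_val] using ⟨hkey, hE⟩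
  have high_le : #{z ∈ forwardPairs (extendByLT G e) N key | ¬ (z.1 < n ∧ z.2 < n)} ≤
      #{z ∈ forwardPairs (extendByLT G e) N id | ¬ (z.1 < n ∧ z.2 < n)} := by
    refine card_le_card fun z hz => ?_
    simp only [forwardPairs, mem_filter] at hz ⊢
    have hlt : z.1 < z.2 := by simpa only [extendByLT, dif_neg hz.2] using hz.1.2.1
    exact ⟨⟨hz.1.1, hz.1.2.1, hlt⟩, hz.2⟩
  rw [← card_filter_add_card_filter_not (s := forwardPairs _ _ key) fun z => z.1 < n ∧ z.2 < n,
    ← card_filter_add_card_filter_not (s := forwardPairs _ _ id) fun z => z.1 < n ∧ z.2 < n,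
    low_eq, low_eq]
  exact Nat.add_le_add (by simpa using he (key ·)) high_le

theorem exists_isMedianOrder [Finite W] (hG : ∀ u v, u ≠ v → G.Adj u v ∨ G.Adj v u) :
    ∃ E, IsMedianOrder E ∧ ∃ e : Fin (Nat.card W) ≃ W, ∀ a b : Fin (Nat.card W),
      E a b → G.Adj (e a) (e b) := by
  obtain ⟨e, he⟩ := exists_equiv_card_forward_le G
  refine ⟨extendByLT G e, ⟨fun a b hab => ?_, ?_⟩, e, fun a b => (extendByLT_val e a b).1⟩
  · by_cases h : a < Nat.card W ∧ b < Nat.card W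
    · simp only [extendByLT, dif_pos h, dif_pos h.symm]
      exact hG _ _ (by simpa using hab)
    · simp only [extendByLT, dif_neg h, dif_neg (mt And.symm h)]
      exact lt_or_gt_of_ne hab
  · exact Filter.eventually_atTop.2 ⟨_, fun N hN => card_forwardPairs_extendByLT_le he hN⟩

end Existence

namespace IsMedianOrder

variable {E : ℕ → ℕ → Prop}

theorem card_back_le_card_forward (hE : IsMedianOrder E) (s v : ℕ) (Y : Finset ℕ) :
    #{z ∈ Ico s v ×ˢ Ico s v | z.1 ∈ Y ∧ z.2 ∉ Y ∧ z.1 < z.2 ∧ E z.2 z.1} ≤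
      #{z ∈ Ico s v ×ˢ Ico s v | z.1 ∈ Y ∧ z.2 ∉ Y ∧ z.1 < z.2 ∧ E z.1 z.2} := by
  set B := {z ∈ Ico s v ×ˢ Ico s v | z.1 ∈ Y ∧ z.2 ∉ Y ∧ z.1 < z.2 ∧ E z.2 z.1} with hB
  set F := {z ∈ Ico s v ×ˢ Ico s v | z.1 ∈ Y ∧ z.2 ∉ Y ∧ z.1 < z.2 ∧ E z.1 z.2} with hF
  obtain ⟨N, hmax, hvN⟩ := (hE.card_forwardPairs_le.and (Filter.eventually_ge_atTop v)).exists
  -- Move the elements of `Y ∩ [s, v)` behind the rest of `[0, v)`.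
  let key : ℕ → ℕ := fun x => if x < v ∧ ¬ (s ≤ x ∧ x ∈ Y) then x else x + v
  have hsub : forwardPairs E N id \ F ∪ B.image Prod.swap ⊆ forwardPairs E N key := by
    rintro ⟨a, b⟩ hz
    simp only [forwardPairs, id, hF, hB, key, mem_union, mem_sdiff, mem_filter, mem_product,
      mem_range, mem_Ico, mem_image, Prod.exists, Prod.swap_prod_mk, Prod.mk.injEq] at hz ⊢
    rcases hz with ⟨⟨hN, hE, hlt⟩, hnF⟩ | ⟨y, x, ⟨⟨hy, hx⟩, hyY, hxY, -, hE⟩, rfl, rfl⟩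
    · refine ⟨hN, hE, ?_⟩
      by_cases ha : s ≤ a ∧ a ∈ Y <;> by_cases hb : s ≤ b ∧ b ∈ Y <;>
        simp only [ha, hb, not_true, not_false_eq_true, and_true, and_false, if_false] <;>
        grind
    · refine ⟨by omega, hE, ?_⟩
      rw [if_pos ⟨hx.2, fun h => hxY h.2⟩, if_neg fun h => h.2 ⟨hy.1, hyY⟩]
      omega
  have hdisj : Disjoint (forwardPairs E N id \ F) (B.image Prod.swap) := by
    rw [disjoint_left]
    rintro ⟨a, b⟩ hz hz'
    simp only [forwardPairs, hB, mem_sdiff, mem_filter, mem_image, Prod.exists, Prod.swap_prod_mk,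
      Prod.mk.injEq, id] at hz hz'
    obtain ⟨y, x, ⟨-, -, -, hlt, -⟩, rfl, rfl⟩ := hz'
    omega
  have hcard := card_le_card hsub
  rw [card_union_of_disjoint hdisj, card_image_of_injective _ Prod.swap_injective] at hcard
  have := le_card_sdiff F (forwardPairs E N id)
  have := hmax key
  omega

theorem sum_card_back_le (hE : IsMedianOrder E) {s v : ℕ} {Y Z R : Finset ℕ}
    (hYZ : Disjoint Y Z) (hnot : ∀ y ∈ Y, ∀ z ∈ Z, ¬ E y z)
    (hR : ∀ x ∈ Ico s v, x ∉ Y → x ∉ Z → x ∈ R) :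
    ∑ y ∈ Y with y ∈ Ico s v, #{z ∈ Z | z ∈ Ioo y v} ≤
      ∑ y ∈ Y with y ∈ Ico s v, #{z ∈ R | z ∈ Ioo y v} := by
  rw [← card_sigma, ← card_sigma]
  refine le_trans (card_le_card_of_injOn (Equiv.sigmaEquivProd ℕ ℕ) ?_ (Equiv.injective _).injOn)
    (le_trans (hE.card_back_le_card_forward s v Y)
      (card_le_card_of_injOn (Equiv.sigmaEquivProd ℕ ℕ).symm ?_ (Equiv.injective _).injOn))
  · rintro ⟨y, z⟩ h
    simp only [coe_sigma, Set.mem_sigma_iff, coe_filter, Set.mem_ofPred_eq, mem_Ico, mem_Ioo,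
      mem_product, Equiv.sigmaEquivProd_apply] at h ⊢
    obtain ⟨⟨hy, hys, hyv⟩, hz, hyz, hzv⟩ := h
    exact ⟨⟨⟨hys, hyv⟩, by omega, hzv⟩, hy, fun hzY => disjoint_left.1 hYZ hzY hz, hyz,
      (hE.total y z hyz.ne).resolve_left (hnot y hy z hz)⟩
  · rintro ⟨y, z⟩ h
    simp only [coe_sigma, Set.mem_sigma_iff, coe_filter, Set.mem_ofPred_eq, mem_Ico, mem_Ioo,
      mem_product, Equiv.sigmaEquivProd_symm_apply] at h ⊢
    obtain ⟨⟨hy', hz⟩, hy, hzY, hyz, hadj⟩ := h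
    exact ⟨⟨hy, hy'⟩, hR z (mem_Ico.2 hz) hzY fun hzZ => hnot y hy z hzZ hadj, hyz, hz.2⟩

theorem le_two_mul_card_out (hE : IsMedianOrder E) (i v : ℕ) :
    v - i - 1 ≤ 2 * #{x ∈ Ioo i v | E i x} := by
  have hmove := hE.sum_card_back_le (s := i) (v := v) (Y := {i})
    (Z := {x ∈ Ioo i v | ¬ E i x}) (R := {x ∈ Ioo i v | E i x}) (by simp) (by simp) (by grind)
  have hsplit : #{x ∈ Ioo i v | E i x} + #{x ∈ Ioo i v | ¬ E i x} = v - i - 1 := by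
    rw [card_filter_add_card_filter_not, Nat.card_Ioo]
  rcases lt_or_ge i v with hiv | hiv
  · have hIoo : ∀ A ⊆ Ioo i v, {x ∈ A | x ∈ Ioo i v} = A := fun A hA =>
      filter_true_of_mem fun x hx => hA hx
    rw [filter_true_of_mem (by simpa using hiv), sum_singleton, sum_singleton,
      hIoo _ (filter_subset _ _), hIoo _ (filter_subset _ _)] at hmove
    omega
  · omega

theorem le_two_mul_card_in (hE : IsMedianOrder E) (q g : ℕ) :
    g - q ≤ 2 * #{x ∈ Ico q g | E x g} := by
  have hmove := hE.card_back_le_card_forward q (g + 1) (Ico q g)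
  have hback : #{x ∈ Ico q g | ¬ E x g} ≤
      #{z ∈ Ico q (g + 1) ×ˢ Ico q (g + 1) |
        z.1 ∈ Ico q g ∧ z.2 ∉ Ico q g ∧ z.1 < z.2 ∧ E z.2 z.1} := by
    refine card_le_card_of_injOn (·, g) (fun x hx => ?_) (Prod.mk_left_injective g).injOn
    have := hE.total x g
    grind
  have hforward : #{z ∈ Ico q (g + 1) ×ˢ Ico q (g + 1) |
        z.1 ∈ Ico q g ∧ z.2 ∉ Ico q g ∧ z.1 < z.2 ∧ E z.1 z.2} ≤ #{x ∈ Ico q g | E x g} := by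
    refine card_le_card_of_injOn Prod.fst (fun z hz => ?_) (fun z hz z' hz' h => ?_)
    · have : z.2 = g := by grind
      grind
    · grind
  have hsplit : #{x ∈ Ico q g | E x g} + #{x ∈ Ico q g | ¬ E x g} = g - q := by
    rw [card_filter_add_card_filter_not, Nat.card_Ico]
  omega

theorem exists_cut (hE : IsMedianOrder E) {s g : ℕ} (hsg : s ≤ g) {Y Z : Finset ℕ}
    (hY : Y ⊆ Ico s g) (hZ : Z ⊆ Ico s g) (hYZ : Disjoint Y Z)
    (hnot : ∀ y ∈ Y, ∀ z ∈ Z, ¬ E y z) :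
    ∃ v, s ≤ v ∧ (∀ y ∈ Y, v ≤ y) ∧
      #{x ∈ Z | v ≤ x} ≤ #{x ∈ Ico s g \ (Y ∪ Z) | v ≤ x} := by
  set R := Ico s g \ (Y ∪ Z)
  let F : ℕ → ℤ := fun v => (#{x ∈ Z | v ≤ x} : ℤ) - #{x ∈ R | v ≤ x}
  -- Cut at the leftmost minimum of `F`.
  obtain ⟨v, hv, hmin⟩ := exists_min_image (Icc s g) (fun v => toLex (F v, v)) (by simpa using hsg)
  have hFv : ∀ u ∈ Icc s g, F v ≤ F u ∧ (u < v → F v < F u) := by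
    intro u hu
    have := hmin u hu
    rw [Prod.Lex.toLex_le_toLex] at this
    grind
  have hFg : F g = 0 := by
    have hempty : ∀ A ⊆ Ico s g, {x ∈ A | g ≤ x} = ∅ := fun A hA =>
      filter_false_of_mem fun x hx => by have := mem_Ico.1 (hA hx); omega
    simp [F, hempty Z hZ, hempty R sdiff_subset]
  have hsplit : ∀ A : Finset ℕ, ∀ y ∉ A, y < v →
      #{x ∈ A | y ≤ x} = #{x ∈ A | x ∈ Ioo y v} + #{x ∈ A | v ≤ x} := by
    intro A y hyA hyv
    rw [← card_union_of_disjoint (disjoint_filter.2 fun x _ h => by grind)]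
    congr 1
    grind
  have hlt : ∀ y ∈ Y, y < v → #{x ∈ R | x ∈ Ioo y v} < #{x ∈ Z | x ∈ Ioo y v} := by
    intro y hy hyv
    have hFy := (hFv y (Ico_subset_Icc_self (hY hy))).2 hyv
    simp only [F] at hFy
    rw [hsplit Z y (disjoint_left.1 hYZ hy) hyv,
      hsplit R y (fun h => (mem_sdiff.1 h).2 (mem_union_left _ hy)) hyv] at hFy
    omega
  refine ⟨v, (mem_Icc.1 hv).1, ?_, ?_⟩
  · by_contra! h
    obtain ⟨y, hy, hyv⟩ := h
    refine (hE.sum_card_back_le (s := s) (v := v) (R := R) hYZ hnot ?_).not_gt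
      (sum_lt_sum_of_nonempty ⟨y, ?_⟩ ?_)
    · grind
    · grind
    · grind
  · have := (hFv g (by simpa using hsg)).1
    simp only [hFg, F] at this
    omega

theorem exists_path_three (hE : IsMedianOrder E) {h s g : ℕ} (hs : h < s) (O : Finset ℕ)
    (hd : s + 6 * #{x ∈ Ico s g | x ∈ O} + (s - h - 1) + 5 ≤ g) :
    ∃ y ∈ Ico s g \ O, ∃ z ∈ Ico s g \ O, y ≠ z ∧ E h y ∧ E y z ∧ E z g := by
  by_contra! H
  -- No edge goes from an out-neighbour of `h` to another in-neighbour of `g`; behind the cut, this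
  -- leaves too few vertices for both neighbourhoods.
  let Y : Finset ℕ := {x ∈ Ico s g \ O | E h x}
  let Z : Finset ℕ := {x ∈ Ico s g \ O | ¬ E h x ∧ E x g}
  let M : Finset ℕ := {x ∈ Ico s g \ O | E h x ∧ E x g}
  have hYZ : Disjoint Y Z := disjoint_filter.2 fun x _ hx hx' => hx'.1 hx
  have hM : #M ≤ 1 := by
    refine card_le_one.2 fun a ha b hb => ?_
    by_contra hne
    have := hE.total a b hne
    grind
  obtain ⟨v, hsv, hYv, hZv⟩ := hE.exists_cut (s := s) (g := g) (Y := Y) (Z := Z) (by omega)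
    ((filter_subset _ _).trans sdiff_subset) ((filter_subset _ _).trans sdiff_subset) hYZ
    (by grind)
  have hparts : #Y + (#{x ∈ Z | v ≤ x} + #{x ∈ Ico s g \ (Y ∪ Z) | v ≤ x}) ≤ g - v := by
    rw [← Nat.card_Ico, ← card_union_of_disjoint, ← card_union_of_disjoint]
    · exact card_le_card (by grind)
    · rw [disjoint_left]; grind
    · rw [disjoint_left]; grind
  have hin : #{x ∈ Ico v g | E x g} ≤ #{x ∈ Z | v ≤ x} + #M + #{x ∈ Ico s g | x ∈ O} := by
    refine (card_le_card ?_).trans ((card_union_le _ _).trans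
      (Nat.add_le_add_right (card_union_le _ _) _))
    grind
  have hout : #{x ∈ Ioo h g | E h x} ≤ (s - h - 1) + #{x ∈ Ico s g | x ∈ O} + #Y := by
    rw [← Nat.card_Ioo]
    refine (card_le_card ?_).trans ((card_union_le _ _).trans
      (Nat.add_le_add_right (card_union_le _ _) _))
    grind
  have := hE.le_two_mul_card_in v g
  have := hE.le_two_mul_card_out h g
  omega

end IsMedianOrder

/-! ### Disjoint directed paths -/

/-- `l` lists the interior vertices, `r + 2` in number and all in `X`, of a directed path of `E`
from `a` to `b`. -/
structure IsPathVia (E : ℕ → ℕ → Prop) (X : Finset ℕ) (a b r : ℕ) (l : List ℕ) : Prop where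
  isChain : List.IsChain E (a :: (l ++ [b]))
  length_eq : l.length = r + 2
  nodup : l.Nodup
  mem : ∀ x ∈ l, x ∈ X

theorem IsPathVia.cons {E : ℕ → ℕ → Prop} {X : Finset ℕ} {a b c r : ℕ} {l : List ℕ}
    (H : IsPathVia E X b c r l) (hab : E a b) (hb : b ∈ X) (hbl : b ∉ l) :
    IsPathVia E X a c (r + 1) (b :: l) where
  isChain := List.isChain_cons_cons.2 ⟨hab, H.isChain⟩
  length_eq := by rw [List.length_cons, H.length_eq]
  nodup := List.nodup_cons.2 ⟨hbl, H.nodup⟩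
  mem := List.forall_mem_cons.2 ⟨hb, H.mem⟩

theorem IsPathVia.mono {E : ℕ → ℕ → Prop} {X X' : Finset ℕ} {a b r : ℕ} {l : List ℕ}
    (H : IsPathVia E X a b r l) (hX : X ⊆ X') : IsPathVia E X' a b r l :=
  ⟨H.isChain, H.length_eq, H.nodup, fun x hx => hX (H.mem x hx)⟩

/-- For each `e ∈ A`, the list `l e` describes a directed path from `h e` to `g e` with `r e + 2`
interior vertices in `X e`, and no two of these paths share an interior vertex. -/
structure IsPathSystem {ι : Type*} (E : ℕ → ℕ → Prop) (A : Finset ι) (X : ι → Finset ℕ)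
    (h g r : ι → ℕ) (l : ι → List ℕ) : Prop where
  path : ∀ e ∈ A, IsPathVia E (X e) (h e) (g e) (r e) (l e)
  disjoint : (A : Set ι).Pairwise fun e f => (l e).Disjoint (l f)

theorem IsPathSystem.update {ι : Type*} {E : ℕ → ℕ → Prop} {A : Finset ι} {X : ι → Finset ℕ}
    {h g r : ι → ℕ} {l : ι → List ℕ} {e : ι} {l' : List ℕ}
    (H : IsPathSystem E (A.erase e) X h g r l) (hl' : IsPathVia E (X e) (h e) (g e) (r e) l')
    (hdisj : ∀ f ∈ A.erase e, l'.Disjoint (l f)) :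
    IsPathSystem E A X h g r (Function.update l e l') where
  path f hf := by
    rcases eq_or_ne f e with rfl | hfe
    · simpa using hl'
    · simpa [hfe] using H.path f (mem_erase.2 ⟨hfe, hf⟩)
  disjoint f hf f' hf' hff' := by
    by_cases hfe : f = e <;> by_cases hfe' : f' = e
    · exact absurd (hfe.trans hfe'.symm) hff'
    · subst hfe
      simpa [hfe'] using hdisj f' (mem_erase.2 ⟨hfe', hf'⟩)
    · subst hfe'
      simpa [hfe] using (hdisj f (mem_erase.2 ⟨hfe, hf⟩)).symm
    · simpa [hfe, hfe'] using
        H.disjoint (mem_erase.2 ⟨hfe, hf⟩) (mem_erase.2 ⟨hfe', hf'⟩) hff'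

theorem IsPathSystem.mono {ι : Type*} {E : ℕ → ℕ → Prop} {A A' : Finset ι} {X X' : ι → Finset ℕ}
    {h g r : ι → ℕ} {l : ι → List ℕ} (H : IsPathSystem E A X h g r l) (hA : A' ⊆ A)
    (hX : ∀ e ∈ A', X e ⊆ X' e) : IsPathSystem E A' X' h g r l where
  path e he := (H.path e (hA he)).mono (hX e he)
  disjoint := H.disjoint.mono (coe_subset.2 hA)

theorem card_Ioo_succ_filter {a p : ℕ} (hap : a < p) (P : ℕ → Prop) :
    #{x ∈ Ioo a (p + 1) | P x} = #{x ∈ Ioo a p | P x} + if P p then 1 else 0 := by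
  have hIoo : Ioo a (p + 1) = insert p (Ioo a p) := by grind
  rw [hIoo, filter_insert]
  split_ifs
  · rw [card_insert_of_notMem (by simp)]
  · rfl

/-- A state of the greedy procedure that embeds disjoint directed paths into a median order,
scanning the positions from left to right. All positions before `pos` have been scanned. The path of
an `active` index `e` has been built up to the vertex `head e`; it still needs `rest e` vertices,
followed by a path of length three to its target. Positions in `reserved` are used by finished
paths. Of the scanned positions, those in `passed` were reserved or were the last head of a finished
path, and those in `skipped` were useless for all active paths. -/
structure GreedyState (ι : Type*) where
  active : Finset ι
  head : ι → ℕ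
  rest : ι → ℕ
  reserved : Finset ℕ
  passed : Finset ℕ
  skipped : Finset ℕ
  pos : ℕ

namespace GreedyState

variable {ι : Type*}

/-- The positions that compensate for skipped ones: the current heads and the passed positions. -/
noncomputable def trail (σ : GreedyState ι) : Finset ℕ := σ.active.image σ.head ∪ σ.passed

/-- The positions that the remaining part of the path of `e` with target `g e` may use. -/
noncomputable def free (σ : GreedyState ι) (g : ι → ℕ) (U : Finset ℕ) (e : ι) : Finset ℕ :=
  Ico σ.pos (g e) \ (σ.reserved ∪ U)

/-- All active paths can be finished simultaneously, reaching the targets `g` and avoiding `U`. -/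
def IsSolvable (E : ℕ → ℕ → Prop) (g : ι → ℕ) (U : Finset ℕ) (σ : GreedyState ι) : Prop :=
  ∃ l, IsPathSystem E σ.active (σ.free g U) σ.head g σ.rest l

/-- The state after passing the reserved position `pos`. -/
noncomputable def pass (σ : GreedyState ι) : GreedyState ι :=
  { σ with passed := insert σ.pos σ.passed, pos := σ.pos + 1 }

/-- The state after skipping the position `pos`. -/
noncomputable def skip (σ : GreedyState ι) : GreedyState ι :=
  { σ with skipped := insert σ.pos σ.skipped, pos := σ.pos + 1 }

/-- The state after extending the path of `e` by the position `pos`. -/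
noncomputable def move (σ : GreedyState ι) (e : ι) : GreedyState ι :=
  { σ with
    head := Function.update σ.head e σ.pos
    rest := Function.update σ.rest e (σ.rest e - 1)
    pos := σ.pos + 1 }

/-- The state after completing the path of `e` by the interior vertices `y` and `z`. -/
noncomputable def finish (σ : GreedyState ι) (e : ι) (y z : ℕ) : GreedyState ι :=
  { σ with
    active := σ.active.erase e
    reserved := insert y (insert z σ.reserved)
    passed := insert (σ.head e) σ.passed }

theorem card_reserved_succ_le (σ : GreedyState ι) :
    #{x ∈ σ.reserved | σ.pos + 1 ≤ x} ≤ #{x ∈ σ.reserved | σ.pos ≤ x} :=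
  card_le_card (by grind)

theorem sum_rest_move (σ : GreedyState ι) {e : ι} (he : e ∈ σ.active) (hrest : 0 < σ.rest e)
    (c : ℕ) :
    ∑ f ∈ σ.active, (σ.rest f + c) = ∑ f ∈ σ.active, ((σ.move e).rest f + c) + 1 := by
  have hothers : ∑ f ∈ σ.active.erase e, ((σ.move e).rest f + c) =
      ∑ f ∈ σ.active.erase e, (σ.rest f + c) :=
    sum_congr rfl fun f hf => by simp only [move, Function.update_of_ne (mem_erase.1 hf).1]
  have hself : (σ.move e).rest e = σ.rest e - 1 := by simp only [move, Function.update_self]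
  rw [← add_sum_erase _ _ he, ← add_sum_erase _ _ he, hothers, hself]
  omega

/-- The invariants of the greedy procedure with targets `g` and obstacles `U`, all of them at or
behind the position `B`. By `room`, the scan never reaches `B`; each active path holds back `13`
positions there, as completing it reserves two positions at the price of `6` each and passes its
head. By `card_gap_le`, a path without rest has its head close enough to `pos` to be completed. -/
structure IsValid (E : ℕ → ℕ → Prop) (g : ι → ℕ) (U : Finset ℕ) (B w : ℕ)
    (σ : GreedyState ι) : Prop where
  target : ∀ e ∈ σ.active, B ≤ g e ∧ 6 * #{x ∈ U | x < g e} ≤ g e - B + w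
  head_lt : ∀ e ∈ σ.active, σ.head e < σ.pos
  passed_lt : ∀ x ∈ σ.passed, x < σ.pos
  skipped_lt : ∀ x ∈ σ.skipped, x < σ.pos
  card_out_le : ∀ e ∈ σ.active,
    #{x ∈ Ioo (σ.head e) σ.pos | E (σ.head e) x} ≤ #{x ∈ σ.trail | σ.head e < x}
  card_skipped_lt_le : ∀ q, #{x ∈ σ.skipped | x < q} ≤ #{x ∈ σ.passed | x < q}
  not_adj_skipped : ∀ e ∈ σ.active, ∀ x ∈ σ.skipped, σ.head e < x → ¬ E (σ.head e) x
  card_gap_le : ∀ e ∈ σ.active, σ.rest e = 0 →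
    σ.pos - σ.head e - 1 + #σ.skipped ≤ #σ.passed
  room : σ.pos + ∑ e ∈ σ.active, (σ.rest e + 13) + 6 * #{x ∈ σ.reserved | σ.pos ≤ x} +
    #σ.passed + w ≤ B + #σ.skipped

namespace IsValid

variable {E : ℕ → ℕ → Prop} {g : ι → ℕ} {U : Finset ℕ} {B w : ℕ} {σ : GreedyState ι}

theorem card_skipped_le (H : σ.IsValid E g U B w) : #σ.skipped ≤ #σ.passed := by
  have := H.card_skipped_lt_le σ.pos
  rwa [filter_true_of_mem H.skipped_lt, filter_true_of_mem H.passed_lt] at this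

theorem room_of_mem (H : σ.IsValid E g U B w) {e : ι} (he : e ∈ σ.active) :
    σ.pos + (σ.rest e + 13) + 6 * #{x ∈ σ.reserved | σ.pos ≤ x} + #σ.passed + w ≤
      B + #σ.skipped := by
  have := single_le_sum (f := fun e => σ.rest e + 13) (fun _ _ => Nat.zero_le _) he
  have := H.room
  omega

theorem pos_lt (H : σ.IsValid E g U B w) {e : ι} (he : e ∈ σ.active) : σ.pos < B := by
  have := H.room_of_mem he
  have := H.card_skipped_le
  omega

theorem lt_pos_of_mem_trail (H : σ.IsValid E g U B w) {x : ℕ} (hx : x ∈ σ.trail) : x < σ.pos := by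
  rcases mem_union.1 hx with hx | hx
  · obtain ⟨e, he, rfl⟩ := mem_image.1 hx
    exact H.head_lt e he
  · exact H.passed_lt x hx

theorem card_filter_trail_insert (H : σ.IsValid E g U B w) {e : ι} (he : e ∈ σ.active) :
    #{x ∈ insert σ.pos σ.trail | σ.head e < x} = #{x ∈ σ.trail | σ.head e < x} + 1 := by
  rw [filter_insert, if_pos (H.head_lt e he), card_insert_of_notMem]
  exact fun hx => lt_irrefl _ (H.lt_pos_of_mem_trail (mem_filter.1 hx).1)

theorem pass (H : σ.IsValid E g U B w) (hrest : ∀ e ∈ σ.active, 0 < σ.rest e)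
    (hpos : σ.pos ∈ σ.reserved) : σ.pass.IsValid E g U B w where
  target := H.target
  head_lt e he := Nat.lt_succ_of_lt (H.head_lt e he)
  passed_lt x hx := by
    have := H.passed_lt x
    grind [GreedyState.pass]
  skipped_lt x hx := Nat.lt_succ_of_lt (H.skipped_lt x hx)
  card_out_le e he := by
    have htrail : σ.pass.trail = insert σ.pos σ.trail := by simp [trail, GreedyState.pass]
    rw [htrail]
    refine le_trans ?_ (Nat.add_le_add_right (H.card_out_le e he) 1 |>.trans_eq
      (H.card_filter_trail_insert he).symm)
    refine (card_Ioo_succ_filter (H.head_lt e he) _).trans_le (Nat.add_le_add_left ?_ _)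
    split_ifs <;> simp
  card_skipped_lt_le q := (H.card_skipped_lt_le q).trans
    (card_le_card (filter_subset_filter _ (subset_insert _ _)))
  not_adj_skipped := H.not_adj_skipped
  card_gap_le e he h0 := absurd h0 (hrest e he).ne'
  room := by
    have hlt : #{x ∈ σ.reserved | σ.pos + 1 ≤ x} < #{x ∈ σ.reserved | σ.pos ≤ x} :=
      card_lt_card ⟨by grind, fun h => by have := @h σ.pos; grind⟩
    have := card_insert_le σ.pos σ.passed
    have := H.room
    change σ.pos + 1 + ∑ e ∈ σ.active, (σ.rest e + 13) + 6 * #{x ∈ σ.reserved | σ.pos + 1 ≤ x} +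
      #(insert σ.pos σ.passed) + w ≤ B + #σ.skipped
    omega

theorem card_insert_pos_skipped_le (hE : IsMedianOrder E) (H : σ.IsValid E g U B w)
    (hA : σ.active.Nonempty) (hpos : ∀ e ∈ σ.active, ¬ E (σ.head e) σ.pos) :
    #(insert σ.pos σ.skipped) ≤ #σ.passed := by
  obtain ⟨e, he, hmax⟩ := exists_max_image σ.active σ.head hA
  have hlt := H.head_lt e he
  -- At least half of the positions behind the rightmost head are out-neighbours of it, and these
  -- are compensated by the trail behind it, which consists of passed positions only.
  have hback : #{x ∈ insert σ.pos σ.skipped | ¬ x ≤ σ.head e} ≤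
      #{x ∈ Ioo (σ.head e) (σ.pos + 1) | ¬ E (σ.head e) x} := by
    refine card_le_card fun x hx => ?_
    have := H.skipped_lt x
    have := H.not_adj_skipped e he x
    grind
  have hsplit : #{x ∈ Ioo (σ.head e) (σ.pos + 1) | E (σ.head e) x} +
      #{x ∈ Ioo (σ.head e) (σ.pos + 1) | ¬ E (σ.head e) x} = σ.pos - σ.head e := by
    rw [card_filter_add_card_filter_not, Nat.card_Ioo]
    omega
  have hhalf := hE.le_two_mul_card_out (σ.head e) (σ.pos + 1)
  have hout := card_Ioo_succ_filter hlt (E (σ.head e) ·)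
  rw [if_neg (hpos e he)] at hout
  have htrail : {x ∈ σ.trail | σ.head e < x} = {x ∈ σ.passed | ¬ x ≤ σ.head e} := by
    grind [trail]
  have hfront : #{x ∈ insert σ.pos σ.skipped | x ≤ σ.head e} ≤ #{x ∈ σ.passed | x ≤ σ.head e} := by
    rw [filter_insert, if_neg (by omega)]
    simpa only [Nat.lt_succ_iff] using H.card_skipped_lt_le (σ.head e + 1)
  have := H.card_out_le e he
  rw [htrail] at this
  rw [← card_filter_add_card_filter_not (s := insert σ.pos σ.skipped) (· ≤ σ.head e),
    ← card_filter_add_card_filter_not (s := σ.passed) (· ≤ σ.head e)]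
  omega

theorem skip (hE : IsMedianOrder E) (H : σ.IsValid E g U B w) (hA : σ.active.Nonempty)
    (hrest : ∀ e ∈ σ.active, 0 < σ.rest e) (hpos : ∀ e ∈ σ.active, ¬ E (σ.head e) σ.pos) :
    σ.skip.IsValid E g U B w where
  target := H.target
  head_lt e he := Nat.lt_succ_of_lt (H.head_lt e he)
  passed_lt x hx := Nat.lt_succ_of_lt (H.passed_lt x hx)
  skipped_lt x hx := by
    have := H.skipped_lt x
    grind [GreedyState.skip]
  card_out_le e he := by
    have hout := card_Ioo_succ_filter (H.head_lt e he) (E (σ.head e) ·)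
    rw [if_neg (hpos e he), add_zero] at hout
    exact hout.trans_le (H.card_out_le e he)
  card_skipped_lt_le q := by
    rcases le_or_gt q σ.pos with hq | hq
    · simpa [GreedyState.skip, filter_insert, hq.not_gt] using H.card_skipped_lt_le q
    · refine (card_filter_le _ _).trans ((card_insert_pos_skipped_le hE H hA hpos).trans_eq ?_)
      exact (congrArg card (filter_true_of_mem fun x hx => (H.passed_lt x hx).trans hq)).symm
  not_adj_skipped e he x hx hlt := by
    rcases mem_insert.1 hx with rfl | hx
    · exact hpos e he
    · exact H.not_adj_skipped e he x hx hlt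
  card_gap_le e he h0 := absurd h0 (hrest e he).ne'
  room := by
    have := card_reserved_succ_le σ
    have := card_insert_of_notMem fun h => lt_irrefl _ (H.skipped_lt σ.pos h)
    have := H.room
    change σ.pos + 1 + ∑ e ∈ σ.active, (σ.rest e + 13) + 6 * #{x ∈ σ.reserved | σ.pos + 1 ≤ x} +
      #σ.passed + w ≤ B + #(insert σ.pos σ.skipped)
    omega

theorem card_filter_trail_move (H : σ.IsValid E g U B w) {e f : ι} (hf : f ∈ σ.active)
    (he : e ∈ σ.active) (hmin : E (σ.head f) σ.pos → σ.head e ≤ σ.head f) :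
    #{x ∈ σ.trail | σ.head f < x} + (if E (σ.head f) σ.pos then 1 else 0) ≤
      #{x ∈ (σ.move e).trail | σ.head f < x} := by
  have hsub : insert σ.pos (σ.trail.erase (σ.head e)) ⊆ (σ.move e).trail := by
    intro x hx
    simp only [trail, GreedyState.move, mem_union, mem_image, mem_insert, mem_erase] at hx ⊢
    rcases hx with rfl | ⟨hxe, ⟨f', hf', rfl⟩ | hx⟩
    · exact .inl ⟨e, he, Function.update_self ..⟩
    · exact .inl ⟨f', hf', Function.update_of_ne (fun h => hxe (congrArg σ.head h)) ..⟩
    · exact .inr hx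
  refine le_trans ?_ (card_le_card (filter_subset_filter _ hsub))
  split_ifs with hadj
  · rw [← H.card_filter_trail_insert hf]
    exact card_le_card (by have := hmin hadj; grind)
  · have hmem : σ.pos ∈ {x ∈ insert σ.pos (σ.trail.erase (σ.head e)) | σ.head f < x} :=
      mem_filter.2 ⟨mem_insert_self _ _, H.head_lt f hf⟩
    rw [← card_erase_add_one hmem, add_zero]
    refine (card_le_card fun x hx => ?_).trans (card_insert_le (σ.head e) _)
    have := H.lt_pos_of_mem_trail (mem_filter.1 hx).1
    grind

theorem move (H : σ.IsValid E g U B w) {e : ι} (he : e ∈ σ.active)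
    (hrest : ∀ f ∈ σ.active, 0 < σ.rest f)
    (hmin : ∀ f ∈ σ.active, E (σ.head f) σ.pos → σ.head e ≤ σ.head f) :
    (σ.move e).IsValid E g U B w where
  target := H.target
  head_lt f hf := by
    have := H.head_lt f hf
    rcases eq_or_ne f e with rfl | hfe
    · simp [GreedyState.move]
    · simpa [GreedyState.move, hfe] using this.le
  passed_lt x hx := Nat.lt_succ_of_lt (H.passed_lt x hx)
  skipped_lt x hx := Nat.lt_succ_of_lt (H.skipped_lt x hx)
  card_out_le f hf := by
    rcases eq_or_ne f e with rfl | hfe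
    · have hhead : (σ.move f).head f = σ.pos := by simp [GreedyState.move]
      have hempty : Ioo σ.pos (σ.move f).pos = ∅ := by grind [GreedyState.move]
      simp [hhead, hempty]
    · have hhead : (σ.move e).head f = σ.head f := Function.update_of_ne hfe ..
      rw [hhead]
      refine le_trans ?_ (H.card_filter_trail_move hf he (hmin f hf))
      exact (card_Ioo_succ_filter (H.head_lt f hf) _).trans_le
        (Nat.add_le_add_right (H.card_out_le f hf) _)
  card_skipped_lt_le := H.card_skipped_lt_le
  not_adj_skipped f hf x hx hlt := by
    rcases eq_or_ne f e with rfl | hfe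
    · have := H.skipped_lt x hx
      simp only [GreedyState.move, Function.update_self] at hlt
      omega
    · simp only [GreedyState.move, Function.update_of_ne hfe] at hlt ⊢
      exact H.not_adj_skipped f hf x hx hlt
  card_gap_le f hf h0 := by
    rcases eq_or_ne f e with rfl | hfe
    · simpa [GreedyState.move] using H.card_skipped_le
    · simp only [GreedyState.move, Function.update_of_ne hfe] at h0
      exact absurd h0 (hrest f hf).ne'
  room := by
    have := σ.sum_rest_move he (hrest e he) 13
    have := card_reserved_succ_le σ
    have := H.room
    change σ.pos + 1 + ∑ f ∈ σ.active, ((σ.move e).rest f + 13) +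
      6 * #{x ∈ σ.reserved | σ.pos + 1 ≤ x} + #σ.passed + w ≤ B + #σ.skipped
    omega

theorem finish (H : σ.IsValid E g U B w) {e : ι} (he : e ∈ σ.active) (y z : ℕ) :
    (σ.finish e y z).IsValid E g U B w where
  target f hf := H.target f (mem_of_mem_erase hf)
  head_lt f hf := H.head_lt f (mem_of_mem_erase hf)
  passed_lt x hx := by
    rcases mem_insert.1 hx with rfl | hx
    · exact H.head_lt e he
    · exact H.passed_lt x hx
  skipped_lt := H.skipped_lt
  card_out_le f hf := by
    refine (H.card_out_le f (mem_of_mem_erase hf)).trans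
      (card_le_card (filter_subset_filter _ fun x hx => ?_))
    simp only [trail, GreedyState.finish, mem_union, mem_image, mem_insert, mem_erase] at hx ⊢
    grind
  card_skipped_lt_le q := (H.card_skipped_lt_le q).trans
    (card_le_card (filter_subset_filter _ (subset_insert _ _)))
  not_adj_skipped f hf := H.not_adj_skipped f (mem_of_mem_erase hf)
  card_gap_le f hf hf0 := (H.card_gap_le f (mem_of_mem_erase hf) hf0).trans
    (card_le_card (subset_insert _ _))
  room := by
    have hsum := add_sum_erase σ.active (fun f => σ.rest f + 13) he
    have hreserved : #{x ∈ insert y (insert z σ.reserved) | σ.pos ≤ x} ≤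
        #{x ∈ σ.reserved | σ.pos ≤ x} + 2 :=
      (card_le_card (t := insert y (insert z {x ∈ σ.reserved | σ.pos ≤ x})) (by grind)).trans
        ((card_insert_le _ _).trans (Nat.add_le_add_right (card_insert_le _ _) _))
    have := card_insert_le (σ.head e) σ.passed
    have := H.room
    change σ.pos + ∑ f ∈ σ.active.erase e, (σ.rest f + 13) +
      6 * #{x ∈ insert y (insert z σ.reserved) | σ.pos ≤ x} + #(insert (σ.head e) σ.passed) + w ≤
      B + #σ.skipped
    omega

end IsValid

variable {E : ℕ → ℕ → Prop} {g : ι → ℕ} {U : Finset ℕ} {B w : ℕ} {σ : GreedyState ι} {e : ι}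

theorem IsValid.exists_completion (hE : IsMedianOrder E) (H : σ.IsValid E g U B w) {e : ι}
    (he : e ∈ σ.active) (h0 : σ.rest e = 0) :
    ∃ y z, IsPathVia E (σ.free g U e) (σ.head e) (g e) 0 [y, z] := by
  have hcard : #{x ∈ Ico σ.pos (g e) | x ∈ σ.reserved ∪ U} ≤
      #{x ∈ σ.reserved | σ.pos ≤ x} + #{x ∈ U | x < g e} :=
    (card_le_card (by grind)).trans (card_union_le _ _)
  have := H.room_of_mem he
  have := H.card_gap_le e he h0
  have := H.target e he
  obtain ⟨y, hy, z, hz, hyz, hadj_y, hadj_yz, hadj_z⟩ :=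
    hE.exists_path_three (H.head_lt e he) (g := g e) (σ.reserved ∪ U) (by omega)
  exact ⟨y, z, by simp [hadj_y, hadj_yz, hadj_z], rfl, by simpa using hyz, by grind [free]⟩

theorem IsSolvable.of_pass (h : σ.pass.IsSolvable E g U) : σ.IsSolvable E g U := by
  obtain ⟨l, hl⟩ := h
  exact ⟨l, hl.mono Subset.rfl fun f _ => by grind [free, pass]⟩

theorem IsSolvable.of_skip (h : σ.skip.IsSolvable E g U) : σ.IsSolvable E g U := by
  obtain ⟨l, hl⟩ := h
  exact ⟨l, hl.mono Subset.rfl fun f _ => by grind [free, skip]⟩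

theorem IsSolvable.of_finish {y z : ℕ} (h : (σ.finish e y z).IsSolvable E g U)
    (hyz : IsPathVia E (σ.free g U e) (σ.head e) (g e) (σ.rest e) [y, z]) :
    σ.IsSolvable E g U := by
  obtain ⟨l, hl⟩ := h
  refine ⟨_, (hl.mono Subset.rfl fun f _ => by grind [free, finish]).update hyz fun f hf => ?_⟩
  rw [List.disjoint_left]
  intro x hx hxl
  have := (hl.path f hf).mem x hxl
  grind [free, finish]

theorem IsSolvable.of_move (h : (σ.move e).IsSolvable E g U) (he : e ∈ σ.active)
    (hrest : 0 < σ.rest e) (hadj : E (σ.head e) σ.pos) (hpos : σ.pos ∈ σ.free g U e) :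
    σ.IsSolvable E g U := by
  obtain ⟨l, hl⟩ := h
  have hfree : ∀ f, (σ.move e).free g U f ⊆ σ.free g U f := fun f => by grind [free, move]
  have hnotMem : ∀ f ∈ σ.active, σ.pos ∉ l f := fun f hf hmem => by
    have := (hl.path f hf).mem _ hmem
    grind [free, move]
  have hpath : IsPathVia E (σ.free g U e) (σ.head e) (g e) (σ.rest e) (σ.pos :: l e) := by
    have := hl.path e he
    simp only [move, Function.update_self] at this
    rw [← Nat.sub_add_cancel hrest]
    exact (this.mono (hfree e)).cons hadj hpos (hnotMem e he)
  have hothers : IsPathSystem E (σ.active.erase e) (σ.free g U) σ.head g σ.rest l := by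
    refine ⟨fun f hf => ?_, hl.disjoint.mono (coe_subset.2 (erase_subset _ _))⟩
    have := hl.path f (mem_of_mem_erase hf)
    simp only [move, Function.update_of_ne (mem_erase.1 hf).1] at this
    exact this.mono (hfree f)
  refine ⟨_, hothers.update hpath fun f hf => List.disjoint_cons_left.2 ⟨?_, ?_⟩⟩
  · exact hnotMem f (mem_of_mem_erase hf)
  · exact hl.disjoint he (mem_of_mem_erase hf) (mem_erase.1 hf).1.symm

theorem IsValid.isSolvable (hE : IsMedianOrder E) (hU : ∀ x ∈ U, B ≤ x)
    (H : σ.IsValid E g U B w) : σ.IsSolvable E g U := by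
  induction hn : B - σ.pos + #σ.active using Nat.strong_induction_on generalizing σ with
  | _ n ih =>
  subst hn
  by_cases! h0 : ∃ e ∈ σ.active, σ.rest e = 0
  · obtain ⟨e, he, h0⟩ := h0
    obtain ⟨y, z, hyz⟩ := H.exists_completion hE he h0
    refine IsSolvable.of_finish (ih _ ?_ (H.finish he y z) rfl) (h0 ▸ hyz)
    exact Nat.add_lt_add_left (card_erase_lt_of_mem he) _
  have hrest : ∀ e ∈ σ.active, 0 < σ.rest e := fun e he => Nat.pos_of_ne_zero (h0 e he)
  rcases σ.active.eq_empty_or_nonempty with hA | hA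
  · exact ⟨fun _ => [], by simp [hA], by simp [hA]⟩
  have hposB : σ.pos < B := H.pos_lt hA.choose_spec
  have hdecr : B - (σ.pos + 1) + #σ.active < B - σ.pos + #σ.active := by omega
  by_cases hres : σ.pos ∈ σ.reserved
  · exact IsSolvable.of_pass (ih _ hdecr (H.pass hrest hres) rfl)
  by_cases! hadj : ∀ e ∈ σ.active, ¬ E (σ.head e) σ.pos
  · exact IsSolvable.of_skip (ih _ hdecr (H.skip hE hA hrest hadj) rfl)
  obtain ⟨e, he, hmin⟩ := exists_min_image {e ∈ σ.active | E (σ.head e) σ.pos} σ.head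
    (filter_nonempty_iff.2 hadj)
  rw [mem_filter] at he
  have hmove := H.move he.1 hrest fun f hf hfadj => hmin f (mem_filter.2 ⟨hf, hfadj⟩)
  refine IsSolvable.of_move (ih _ hdecr hmove rfl) he.1 (hrest e he.1) he.2 ?_
  have := (H.target e he.1).1
  have := hU σ.pos
  grind [free]

end GreedyState

theorem IsMedianOrder.exists_isPathSystem {E : ℕ → ℕ → Prop} (hE : IsMedianOrder E) {ι : Type*}
    {A : Finset ι} {h g r : ι → ℕ} {U : Finset ℕ} {a p b w : ℕ} (hU : ∀ x ∈ U, b ≤ x)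
    (hhead : ∀ e ∈ A, a ≤ h e ∧ h e < p)
    (htarget : ∀ e ∈ A, b ≤ g e ∧ 6 * #{x ∈ U | x < g e} ≤ g e - b + w)
    (hroom : p + ∑ e ∈ A, (r e + 13) + (p - a) + w ≤ b) :
    ∃ l, IsPathSystem E A (fun e => Ico p (g e) \ U) h g r l := by
  let σ : GreedyState ι := ⟨A, h, r, ∅, Ico a p, ∅, p⟩
  have H : σ.IsValid E g U b w := {
    target := htarget
    head_lt := fun e he => (hhead e he).2
    passed_lt := fun x hx => (mem_Ico.1 hx).2
    skipped_lt := by simp [σ]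
    card_out_le := fun e he => card_le_card (by
      have := hhead e he
      grind [GreedyState.trail])
    card_skipped_lt_le := by simp [σ]
    not_adj_skipped := by simp [σ]
    card_gap_le := fun e he _ => by
      have := hhead e he
      change p - h e - 1 + 0 ≤ #(Ico a p)
      rw [Nat.card_Ico]
      omega
    room := by simpa [σ] using hroom }
  obtain ⟨l, hl⟩ := H.isSolvable hE hU
  exact ⟨l, hl.mono Subset.rfl fun e _ => by simp [σ, GreedyState.free]⟩

/-! ### Sparse embeddings of forests -/

theorem exists_subsingleton_neighborSet {V : Type*} [Finite V] [Nonempty V] {H : SimpleGraph V}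
    (hH : H.IsAcyclic) : ∃ v, (H.neighborSet v).Subsingleton := by
  have ⟨u, v, p, hp, hmax⟩ := SimpleGraph.Walk.exists_isPath_forall_isPath_length_le_length H
  have hsnd : ∀ w, H.Adj u w → w = p.snd := fun w hw => by
    refine hH.eq_snd_of_adj_start hp hw ?_
    by_contra hwp
    have := hmax _ _ _ (hp.cons (h := hw.symm) hwp)
    grind [SimpleGraph.Walk.length_cons]
  exact ⟨u, fun w hw w' hw' => (hsnd w hw).trans (hsnd w' hw').symm⟩

theorem exists_mem_neighborSet_inter_subsingleton {V : Type*} {H : SimpleGraph V}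
    (hH : H.IsAcyclic) {S : Finset V} (hS : S.Nonempty) :
    ∃ x ∈ S, (H.neighborSet x ∩ S).Subsingleton := by
  have := hS.to_subtype
  obtain ⟨x, hx⟩ := exists_subsingleton_neighborSet (hH.induce (S : Set V))
  exact ⟨x, x.2, fun y hy z hz =>
    congrArg Subtype.val (@hx ⟨y, hy.2⟩ hy.1 ⟨z, hz.2⟩ hz.1)⟩

theorem underlying_adj {V : Type*} {T : Digraph V} (hT : T.IsOrientedGraph) {u v : V} :
    T.underlying.Adj u v ↔ T.Adj u v ∨ T.Adj v u := by
  refine (SimpleGraph.fromRel_adj _ _ _).trans (and_iff_right_of_imp ?_)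
  rintro (h | h) rfl <;> exact hT _ _ h h

/-- `f` embeds `T` restricted to `S` in the interval of length `4 * #S` of `E` that starts at `B`,
using at most about half of each initial and of each final part of the interval. -/
structure IsSparseEmbedding {V : Type*} (E : ℕ → ℕ → Prop) (T : Digraph V) (S : Finset V) (B : ℕ)
    (f : V → ℕ) : Prop where
  injOn : Set.InjOn f S
  mem : ∀ x ∈ S, B ≤ f x ∧ f x < B + 4 * #S
  adj : ∀ u ∈ S, ∀ v ∈ S, T.Adj u v → E (f u) (f v)
  card_lt_le : ∀ q, 2 * #{x ∈ S | f x < q} ≤ q - B + 1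
  card_ge_le : ∀ q, 2 * #{x ∈ S | q ≤ f x} ≤ B + 4 * #S - q + 1

namespace IsSparseEmbedding

variable {V : Type*} {E : ℕ → ℕ → Prop} {T : Digraph V} {S : Finset V} {B : ℕ} {f : V → ℕ}

theorem exists_out (H : IsSparseEmbedding E T S (B + 2) f) (hE : IsMedianOrder E) {y : V}
    (hy : y ∈ S) : ∃ j, B ≤ j ∧ j < B + 4 * (#S + 1) ∧ j ∉ S.image f ∧ E (f y) j := by
  have := H.mem y hy
  have := H.card_ge_le (f y + 1)
  have := hE.le_two_mul_card_out (f y) (B + 4 * (#S + 1))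
  obtain ⟨j, hj, hjn⟩ := exists_mem_notMem_of_card_lt_card
    (s := {x ∈ S | f y + 1 ≤ f x}.image f)
    (t := {j ∈ Ioo (f y) (B + 4 * (#S + 1)) | E (f y) j})
    (card_image_le.trans_lt (by omega))
  exact ⟨j, by grind⟩

theorem exists_in (H : IsSparseEmbedding E T S (B + 2) f) (hE : IsMedianOrder E) {y : V}
    (hy : y ∈ S) : ∃ j, B ≤ j ∧ j < B + 4 * (#S + 1) ∧ j ∉ S.image f ∧ E j (f y) := by
  have := H.mem y hy
  have := H.card_lt_le (f y)
  have := hE.le_two_mul_card_in B (f y)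
  obtain ⟨j, hj, hjn⟩ := exists_mem_notMem_of_card_lt_card
    (s := {x ∈ S | f x < f y}.image f)
    (t := {j ∈ Ico B (f y) | E j (f y)})
    (card_image_le.trans_lt (by omega))
  exact ⟨j, by grind⟩

theorem exists_position (H : IsSparseEmbedding E T S (B + 2) f) (hE : IsMedianOrder E)
    (hT : T.IsOrientedGraph) {x : V} (hx : (T.underlying.neighborSet x ∩ S).Subsingleton) :
    ∃ j, B ≤ j ∧ j < B + 4 * (#S + 1) ∧ j ∉ S.image f ∧
      ∀ y ∈ S, (T.Adj y x → E (f y) j) ∧ (T.Adj x y → E j (f y)) := by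
  have hout : ∀ y, T.Adj x y → y ∈ T.underlying.neighborSet x := fun y h =>
    (underlying_adj hT).2 (.inl h)
  have hin : ∀ y, T.Adj y x → y ∈ T.underlying.neighborSet x := fun y h =>
    (underlying_adj hT).2 (.inr h)
  by_cases! hnone : ∀ y ∈ S, ¬ T.Adj y x ∧ ¬ T.Adj x y
  · refine ⟨B, le_rfl, by omega, fun hB => ?_, fun y hy =>
      ⟨fun h => absurd h (hnone y hy).1, fun h => absurd h (hnone y hy).2⟩⟩
    obtain ⟨y, hy, hyB⟩ := mem_image.1 hB
    have := H.mem y hy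
    omega
  obtain ⟨y, hy, hyx_or⟩ := hnone
  by_cases hyx : T.Adj y x
  · obtain ⟨j, hBj, hj, hjf, hadj⟩ := H.exists_out hE hy
    refine ⟨j, hBj, hj, hjf, fun z hz => ?_⟩
    have huniq := fun h : z ∈ T.underlying.neighborSet x => hx ⟨h, hz⟩ ⟨hin y hyx, hy⟩
    exact ⟨fun h => huniq (hin z h) ▸ hadj, fun h => absurd (huniq (hout z h) ▸ hyx) (hT _ _ h)⟩
  · have hxy := hyx_or hyx
    obtain ⟨j, hBj, hj, hjf, hadj⟩ := H.exists_in hE hy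
    refine ⟨j, hBj, hj, hjf, fun z hz => ?_⟩
    have huniq := fun h : z ∈ T.underlying.neighborSet x => hx ⟨h, hz⟩ ⟨hout y hxy, hy⟩
    exact ⟨fun h => absurd (huniq (hin z h) ▸ hxy) (hT _ _ h), fun h => huniq (hout z h) ▸ hadj⟩

theorem card_filter_update_le {x : V} (hx : x ∈ S) (j : ℕ) (P : ℕ → Prop) [DecidablePred P] :
    #{y ∈ S | P (Function.update f x j y)} ≤
      #{y ∈ S.erase x | P (f y)} + if P j then 1 else 0 := by
  rw [← insert_erase hx, filter_insert, Function.update_self, erase_insert (notMem_erase x S),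
    filter_congr (q := fun y => P (f y)) fun y hy => by
      rw [Function.update_of_ne (ne_of_mem_erase hy)]]
  split_ifs
  · exact card_insert_le _ _
  · rfl

theorem card_update_lt_le {x : V} (hx : x ∈ S)
    (H : IsSparseEmbedding E T (S.erase x) (B + 2) f) {j : ℕ} (hBj : B ≤ j) (q : ℕ) :
    2 * #{y ∈ S | Function.update f x j y < q} ≤ q - B + 1 := by
  have hle : #{y ∈ S | Function.update f x j y < q} ≤
      #{y ∈ S.erase x | f y < q} + if j < q then 1 else 0 := card_filter_update_le hx j (· < q)
  have hzero : q ≤ B + 2 → #{y ∈ S.erase x | f y < q} = 0 := fun hq => by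
    rw [card_eq_zero, filter_eq_empty_iff]
    intro y hy
    have := H.mem y hy
    omega
  have := H.card_lt_le q
  split_ifs at hle <;> omega

theorem card_update_ge_le {x : V} (hx : x ∈ S)
    (H : IsSparseEmbedding E T (S.erase x) (B + 2) f) {j : ℕ} (hj : j < B + 4 * #S) (q : ℕ) :
    2 * #{y ∈ S | q ≤ Function.update f x j y} ≤ B + 4 * #S - q + 1 := by
  have hcard : #(S.erase x) + 1 = #S := card_erase_add_one hx
  have hle : #{y ∈ S | q ≤ Function.update f x j y} ≤
      #{y ∈ S.erase x | q ≤ f y} + if q ≤ j then 1 else 0 := card_filter_update_le hx j (q ≤ ·)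
  have hzero : B + 4 * #S ≤ q + 2 → #{y ∈ S.erase x | q ≤ f y} = 0 := fun hq => by
    rw [card_eq_zero, filter_eq_empty_iff]
    intro y hy
    have := H.mem y hy
    omega
  have := H.card_ge_le q
  split_ifs at hle <;> omega

theorem update {x : V} (hx : x ∈ S) (H : IsSparseEmbedding E T (S.erase x) (B + 2) f)
    (hT : T.IsOrientedGraph) {j : ℕ} (hBj : B ≤ j) (hj : j < B + 4 * #S)
    (hjf : j ∉ (S.erase x).image f)
    (hadj : ∀ y ∈ S.erase x, (T.Adj y x → E (f y) j) ∧ (T.Adj x y → E j (f y))) :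
    IsSparseEmbedding E T S B (Function.update f x j) := by
  have hcard : #(S.erase x) + 1 = #S := card_erase_add_one hx
  have hmem := H.mem
  have hS : S = insert x (S.erase x) := (insert_erase hx).symm
  have hother : ∀ y ∈ S.erase x, Function.update f x j y = f y := fun y hy =>
    Function.update_of_ne (ne_of_mem_erase hy) ..
  constructor
  · rw [hS, coe_insert, Set.injOn_insert (by simp)]
    refine ⟨H.injOn.congr fun y hy => (hother y hy).symm, ?_⟩
    rintro ⟨y, hy, hyj⟩
    rw [hother y hy, Function.update_self] at hyj
    exact hjf (mem_image.2 ⟨y, hy, hyj⟩)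
  · intro y hy
    rcases eq_or_ne y x with rfl | hyx
    · simpa using ⟨hBj, hj⟩
    · rw [Function.update_of_ne hyx]
      have := hmem y (mem_erase.2 ⟨hyx, hy⟩)
      omega
  · intro u hu v hv huv
    have huv' : u ≠ v := ((underlying_adj hT).2 (.inl huv)).ne
    by_cases hux : u = x
    · subst hux
      have hv' := mem_erase.2 ⟨huv'.symm, hv⟩
      simpa [huv'.symm] using (hadj v hv').2 huv
    have hu' := mem_erase.2 ⟨hux, hu⟩
    by_cases hvx : v = x
    · subst hvx
      simpa [huv'] using (hadj u hu').1 huv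
    · simpa [hux, hvx] using H.adj u hu' v (mem_erase.2 ⟨hvx, hv⟩) huv
  · exact H.card_update_lt_le hx hBj
  · exact H.card_update_ge_le hx hj

theorem card_image_lt_le (H : IsSparseEmbedding E T S B f) {x : V} (hx : x ∈ S) :
    6 * #{y ∈ S.image f | y < f x} ≤ f x - B + 4 * #S := by
  have := H.mem x hx
  have := H.card_lt_le (f x)
  have : #{y ∈ S | f y < f x} < #S := card_lt_card (filter_ssubset.2 ⟨x, hx, by omega⟩)
  have : #{y ∈ S.image f | y < f x} ≤ #{y ∈ S | f y < f x} := by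
    rw [filter_image]
    exact card_image_le
  omega

theorem congr {g : V → ℕ} (H : IsSparseEmbedding E T S B f) (hfg : ∀ x ∈ S, f x = g x) :
    IsSparseEmbedding E T S B g where
  injOn := H.injOn.congr hfg
  mem x hx := hfg x hx ▸ H.mem x hx
  adj u hu v hv huv := hfg u hu ▸ hfg v hv ▸ H.adj u hu v hv huv
  card_lt_le q := by
    have := filter_congr (p := fun x => f x < q) (q := fun x => g x < q) fun x hx => by
      rw [hfg x hx]
    exact this ▸ H.card_lt_le q
  card_ge_le q := by
    have := filter_congr (p := fun x => q ≤ f x) (q := fun x => q ≤ g x) fun x hx => by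
      rw [hfg x hx]
    exact this ▸ H.card_ge_le q

end IsSparseEmbedding

theorem IsMedianOrder.exists_isSparseEmbedding {V : Type*} {E : ℕ → ℕ → Prop} {T : Digraph V}
    (hE : IsMedianOrder E) (hT : T.IsOrientedGraph) (hacyclic : T.underlying.IsAcyclic)
    (S : Finset V) (B : ℕ) : ∃ f, IsSparseEmbedding E T S B f := by
  induction hm : #S generalizing S B with
  | zero =>
    rw [card_eq_zero] at hm
    exact ⟨fun _ => 0, by simp [hm], by simp [hm], by simp [hm], by simp [hm], by simp [hm]⟩
  | succ m ih =>
    obtain ⟨x, hx, hnbr⟩ := exists_mem_neighborSet_inter_subsingleton hacyclic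
      (S := S) (card_pos.1 (by omega))
    have hcard : #(S.erase x) + 1 = #S := card_erase_add_one hx
    obtain ⟨f, hf⟩ := ih (S.erase x) (B + 2) (by omega)
    obtain ⟨j, hBj, hj, hjf, hadj⟩ := hf.exists_position hE hT
      (hnbr.anti (Set.inter_subset_inter_right _ (coe_subset.2 (erase_subset x S))))
    exact ⟨_, hf.update hx hT hBj (hcard ▸ hj) hjf hadj⟩

theorem exists_int_potential {V : Type*} {H : SimpleGraph V} (hH : H.IsTree) {c : V → V → ℤ}
    (hc : ∀ u v, H.Adj u v → c v u = -c u v) :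
    ∃ φ : V → ℤ, ∀ u v, H.Adj u v → φ v = φ u + c u v := by
  obtain ⟨root⟩ := hH.connected.nonempty
  choose p hp _ using fun v => hH.existsUnique_path root v
  let φ (v : V) : ℤ := ((p v).darts.map fun d => c d.fst d.snd).sum
  have hφ (u v : V) (huv : H.Adj u v) (hu : u ∈ (p v).support) : φ v = φ u + c u v := by
    simp [φ, hH.isAcyclic.path_concat (hp u) (hp v) huv hu, SimpleGraph.Walk.darts_concat]
  refine ⟨φ, fun u v huv => ?_⟩
  by_cases hu : u ∈ (p v).support
  · exact hφ u v huv hu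
  · have hv := hH.isAcyclic.mem_support_of_ne_mem_support_of_adj_of_isPath (hp u) (hp v) huv hu
    have := hφ v u huv.symm hv
    have := hc u v huv
    omega

theorem exists_potential {V : Type*} [Finite V] {T : Digraph V} (hT : T.IsOrientedTree)
    (c : V → V → ℕ) : ∃ φ : V → ℕ, ∀ u v, T.Adj u v → φ v = φ u + c u v := by
  obtain ⟨φ, hφ⟩ := exists_int_potential hT.2 (c := fun u v => if T.Adj u v then c u v else -c v u)
    fun u v huv => by grind [underlying_adj hT.1, Digraph.IsOrientedGraph, hT.1]
  have := hT.2.connected.nonempty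
  obtain ⟨m, hm⟩ := Finite.exists_min φ
  refine ⟨fun v => (φ v - φ m).toNat, fun u v huv => ?_⟩
  have := hφ u v ((underlying_adj hT.1).2 (.inl huv))
  have := hm u
  have := hm v
  grind

theorem card_adj_lt {V : Type*} [Fintype V] {T : Digraph V} (hT : T.IsOrientedTree) :
    #{z : V × V | T.Adj z.1 z.2} < Fintype.card V := by
  rw [← hT.2.card_edgeFinset, Nat.lt_succ_iff]
  refine card_le_card_of_injOn (fun z => s(z.1, z.2)) (fun z hz => ?_) fun z hz z' hz' h => ?_
  · simpa [SimpleGraph.mem_edgeFinset, -SimpleGraph.fromRel_adj, underlying_adj hT.1] using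
      Or.inl (mem_filter.1 hz).2
  · rcases Sym2.eq_iff.1 h with ⟨h1, h2⟩ | ⟨h1, h2⟩
    · exact Prod.ext h1 h2
    · exact absurd (h1 ▸ h2 ▸ (mem_filter.1 hz').2) (hT.1 _ _ (mem_filter.1 hz).2)

/-! ### Runs of vertices of degree two -/

/-- Within `T`, the vertices `x` of `L` have the one in-neighbour `pred x` and the one out-neighbour
`succ x`, so that `L` splits into runs `x, succ x, succ (succ x), …` inside directed paths. -/
structure IsBareSet {V : Type*} (T : Digraph V) (L : Finset V) (pred succ : V → V) : Prop where
  adj_left : ∀ x ∈ L, ∀ y, T.Adj y x ↔ y = pred x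
  adj_right : ∀ x ∈ L, ∀ y, T.Adj x y ↔ y = succ x

/-- The first vertices of the runs of `L`. -/
noncomputable def runStarts {V : Type*} (L : Finset V) (pred : V → V) : Finset V :=
  {x ∈ L | pred x ∉ L}

/-- The number of vertices of `L` in the run that starts at `e`; it is `0` if the run does not leave
`L`, which does not happen in acyclic graphs. -/
noncomputable def runLength {V : Type*} (L : Finset V) (succ : V → V) (e : V) : ℕ :=
  sInf {i | succ^[i] e ∉ L}

theorem iterate_mem_of_lt_runLength {V : Type*} {L : Finset V} {succ : V → V} {e : V} {i : ℕ}
    (hi : i < runLength L succ e) : succ^[i] e ∈ L :=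
  not_not.1 (Nat.notMem_of_lt_sInf hi)

namespace IsBareSet

variable {V : Type*} {T : Digraph V} {L : Finset V} {pred succ : V → V} {H : V → ℕ}

theorem mono {L' : Finset V} (hL : IsBareSet T L pred succ) (h : L' ⊆ L) :
    IsBareSet T L' pred succ :=
  ⟨fun x hx => hL.adj_left x (h hx), fun x hx => hL.adj_right x (h hx)⟩

theorem adj_pred (hL : IsBareSet T L pred succ) {x : V} (hx : x ∈ L) : T.Adj (pred x) x :=
  (hL.adj_left x hx _).2 rfl

theorem adj_succ (hL : IsBareSet T L pred succ) {x : V} (hx : x ∈ L) : T.Adj x (succ x) :=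
  (hL.adj_right x hx _).2 rfl

theorem succ_pred (hL : IsBareSet T L pred succ) {x : V} (hx : x ∈ L) (hp : pred x ∈ L) :
    succ (pred x) = x :=
  ((hL.adj_right _ hp _).1 (hL.adj_pred hx)).symm

theorem pred_succ (hL : IsBareSet T L pred succ) {x : V} (hx : x ∈ L) (hs : succ x ∈ L) :
    pred (succ x) = x :=
  ((hL.adj_left _ hs _).1 (hL.adj_succ hx)).symm

section Runs

variable (hL : IsBareSet T L pred succ)
include hL

theorem pred_iterate_succ {e : V} {i : ℕ} (hi : i + 1 < runLength L succ e) :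
    pred (succ^[i + 1] e) = succ^[i] e := by
  have hi1 := iterate_mem_of_lt_runLength hi
  rw [Function.iterate_succ_apply'] at hi1 ⊢
  exact hL.pred_succ (iterate_mem_of_lt_runLength (by omega)) hi1

theorem iterate_injective {e e' : V} {i i' : ℕ} (he : e ∈ runStarts L pred)
    (he' : e' ∈ runStarts L pred) (hi : i < runLength L succ e) (hi' : i' < runLength L succ e')
    (h : succ^[i] e = succ^[i'] e') : e = e' ∧ i = i' := by
  induction i generalizing i' with
  | zero =>
    cases i' with
    | zero => exact ⟨h, rfl⟩
    | succ i' =>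
      refine absurd (iterate_mem_of_lt_runLength ((Nat.lt_succ_self i').trans hi')) ?_
      rw [← hL.pred_iterate_succ hi', ← h]
      exact (mem_filter.1 he).2
  | succ i ih =>
    cases i' with
    | zero =>
      refine absurd (iterate_mem_of_lt_runLength ((Nat.lt_succ_self i).trans hi)) ?_
      rw [← hL.pred_iterate_succ hi, h]
      exact (mem_filter.1 he').2
    | succ i' =>
      have hpred : succ^[i] e = succ^[i'] e' := by
        rw [← hL.pred_iterate_succ hi, ← hL.pred_iterate_succ hi', h]
      exact (ih (by omega) (by omega) hpred).imp_right (congrArg (· + 1))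

variable (hH : ∀ u v, T.Adj u v → H u < H v)
include hH

theorem iterate_runLength_notMem (e : V) : succ^[runLength L succ e] e ∉ L := by
  suffices h : {i | succ^[i] e ∉ L}.Nonempty from Nat.sInf_mem h
  by_contra! h
  have hmem (i : ℕ) : succ^[i] e ∈ L := by
    by_contra hi
    exact h.le hi
  have hmono : StrictMono fun i => H (succ^[i] e) := strictMono_nat_of_lt_succ fun i => by
    rw [Function.iterate_succ_apply']
    exact hH _ _ (hL.adj_succ (hmem i))
  have hlt := hmono.le_apply (x := L.sup H + 1)
  have hle := le_sup (f := H) (hmem (L.sup H + 1))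
  omega

theorem exists_iterate_eq {x : V} (hx : x ∈ L) :
    ∃ e ∈ runStarts L pred, ∃ i < runLength L succ e, succ^[i] e = x := by
  have lt_runLength {e : V} {i : ℕ} (hi : i ≤ runLength L succ e) (hiL : succ^[i] e ∈ L) :
      i < runLength L succ e :=
    hi.lt_of_ne fun h => hL.iterate_runLength_notMem hH e (h ▸ hiL)
  induction hm : H x using Nat.strong_induction_on generalizing x with
  | _ m ih =>
    by_cases hp : pred x ∈ L
    · obtain ⟨e, he, i, hi, hix⟩ := ih _ (hm ▸ hH _ _ (hL.adj_pred hx)) hp rfl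
      have hix' : succ^[i + 1] e = x := by
        rw [Function.iterate_succ_apply', hix, hL.succ_pred hx hp]
      exact ⟨e, he, i + 1, lt_runLength hi (hix' ▸ hx), hix'⟩
    · exact ⟨x, mem_filter.2 ⟨hx, hp⟩, 0, lt_runLength (Nat.zero_le _) hx, rfl⟩

theorem sum_runLength : ∑ e ∈ runStarts L pred, runLength L succ e = #L := by
  have hsigma : ∑ e ∈ runStarts L pred, runLength L succ e =
      #((runStarts L pred).sigma fun e => range (runLength L succ e)) := by
    simp only [card_sigma, card_range]
  rw [hsigma]
  refine card_nbij (fun z => succ^[z.2] z.1) (fun z hz => ?_) (fun z hz z' hz' h => ?_)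
    fun x hx => ?_
  · rw [mem_coe, mem_sigma, mem_range] at hz
    exact iterate_mem_of_lt_runLength hz.2
  · simp only [coe_sigma, Set.mem_sigma_iff, mem_coe, mem_range] at hz hz'
    obtain ⟨h1, h2⟩ := hL.iterate_injective hz.1 hz'.1 hz.2 hz'.2 h
    exact Sigma.ext h1 (heq_of_eq h2)
  · obtain ⟨e, he, i, hi, rfl⟩ := hL.exists_iterate_eq hH hx
    exact ⟨⟨e, i⟩, by simpa using ⟨he, hi⟩, rfl⟩

theorem two_le_runLength (hlong : ∀ x ∈ L, pred x ∈ L ∨ succ x ∈ L) {e : V}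
    (he : e ∈ runStarts L pred) : 2 ≤ runLength L succ e := by
  obtain ⟨heL, hp⟩ := mem_filter.1 he
  by_contra! h
  have hnot := hL.iterate_runLength_notMem hH e
  interval_cases runLength L succ e
  · exact hnot heL
  · exact hnot ((hlong e heL).resolve_left hp)

end Runs

section Embedding

variable {E : ℕ → ℕ → Prop} {M : Finset V} {φ : V → ℕ}

theorem exists_extension (hM : IsBareSet T M pred succ) (hH : ∀ u v, T.Adj u v → H u < H v)
    (φ : V → ℕ) (l : V → List ℕ) : ∃ f : V → ℕ, (∀ x ∉ M, f x = φ x) ∧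
      ∀ e ∈ runStarts M pred, ∀ i < runLength M succ e, f (succ^[i] e) = (l e).getD i 0 := by
  choose! e he i hi hei using fun x (hx : x ∈ M) => hM.exists_iterate_eq hH hx
  refine ⟨fun x => if x ∈ M then (l (e x)).getD (i x) 0 else φ x, fun x hx => if_neg hx,
    fun e' he' i' hi' => ?_⟩
  have hmem := iterate_mem_of_lt_runLength hi'
  obtain ⟨h1, h2⟩ := hM.iterate_injective (he _ hmem) he' (hi _ hmem) hi' (hei _ hmem)
  simp only [if_pos hmem, h1, h2]

section PathSystem

variable {X : V → Finset ℕ} {f : V → ℕ} {l : V → List ℕ}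

theorem adj_of_isPathVia (hM : IsBareSet T M pred succ) (hH : ∀ u v, T.Adj u v → H u < H v)
    (hlong : ∀ x ∈ M, pred x ∈ M ∨ succ x ∈ M)
    (hl : ∀ e ∈ runStarts M pred, IsPathVia E (X e) (f (pred e)) (f (succ^[runLength M succ e] e))
      (runLength M succ e - 2) (l e))
    (hf : ∀ e ∈ runStarts M pred, ∀ i < runLength M succ e, f (succ^[i] e) = (l e).getD i 0)
    {u v : V} (huv : T.Adj u v) (hmem : u ∈ M ∨ v ∈ M) : E (f u) (f v) := by
  have hlen (e : V) (he : e ∈ runStarts M pred) : (l e).length = runLength M succ e := by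
    have := hM.two_le_runLength hH hlong he
    have := (hl e he).length_eq
    omega
  have hwalk (e : V) (he : e ∈ runStarts M pred) (i : ℕ) (hi : i ≤ (l e).length) :
      (l e ++ [f (succ^[runLength M succ e] e)])[i]? = some (f (succ^[i] e)) := by
    rcases hi.lt_or_eq with hi | rfl
    · rw [List.getElem?_append_left hi, List.getElem?_eq_getElem hi, hf e he i (hlen e he ▸ hi),
        List.getD_eq_getElem]
    · rw [List.getElem?_concat_length, hlen e he]
  have hchain (e : V) (he : e ∈ runStarts M pred) :=
    List.isChain_iff_getElem.1 (hl e he).isChain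
  by_cases hu : u ∈ M
  · obtain ⟨e, he, i, hi, rfl⟩ := hM.exists_iterate_eq hH hu
    rw [(hM.adj_right _ hu v).1 huv, ← Function.iterate_succ_apply' succ]
    have hadj := hchain e he (i + 1)
    have hu := hwalk e he i
    have hv := hwalk e he (i + 1)
    have := hlen e he
    clear hchain hwalk hlen
    grind
  · have hv := hmem.resolve_left hu
    have hpv := (hM.adj_left v hv u).1 huv
    have he : v ∈ runStarts M pred := mem_filter.2 ⟨hv, hpv ▸ hu⟩
    have hadj := hchain v he 0
    have hv := hwalk v he 0
    clear hchain hwalk hlen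
    grind [Function.iterate_zero_apply]

theorem exists_embedding_of_isPathSystem (hM : IsBareSet T M pred succ)
    (hH : ∀ u v, T.Adj u v → H u < H v) (hlong : ∀ x ∈ M, pred x ∈ M ∨ succ x ∈ M)
    (hl : IsPathSystem E (runStarts M pred) X (fun e => φ (pred e))
      (fun e => φ (succ^[runLength M succ e] e)) (fun e => runLength M succ e - 2) l) :
    ∃ f : V → ℕ, (∀ x ∉ M, f x = φ x) ∧ Set.InjOn f M ∧
      (∀ x ∈ M, ∃ e ∈ runStarts M pred, f x ∈ X e) ∧
      ∀ u v, T.Adj u v → u ∈ M ∨ v ∈ M → E (f u) (f v) := by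
  obtain ⟨f, hfφ, hfl⟩ := hM.exists_extension hH φ l
  have hmem (x : V) (hx : x ∈ M) : ∃ e ∈ runStarts M pred, ∃ i < runLength M succ e,
      succ^[i] e = x ∧ ∃ hi : i < (l e).length, f x = (l e)[i] := by
    obtain ⟨e, he, i, hi, rfl⟩ := hM.exists_iterate_eq hH hx
    have := hM.two_le_runLength hH hlong he
    have := (hl.path e he).length_eq
    exact ⟨e, he, i, hi, rfl, by omega, by rw [hfl e he i hi, List.getD_eq_getElem]⟩
  refine ⟨f, hfφ, fun x hx y hy hxy => ?_, fun x hx => ?_, fun u v huv hmemM => ?_⟩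
  · obtain ⟨e, he, i, -, rfl, hi, hfx⟩ := hmem x hx
    obtain ⟨e', he', i', -, rfl, hi', hfy⟩ := hmem y hy
    rw [hfx, hfy] at hxy
    obtain rfl : e = e' := by
      by_contra hne
      exact hl.disjoint he he' hne (List.getElem_mem hi) (hxy ▸ List.getElem_mem hi')
    rw [(hl.path e he).nodup.getElem_inj_iff.1 hxy]
  · obtain ⟨e, he, i, -, -, hi, hfx⟩ := hmem x hx
    exact ⟨e, he, hfx ▸ (hl.path e he).mem _ (List.getElem_mem hi)⟩
  · refine hM.adj_of_isPathVia (X := X) hH hlong (fun e he => ?_) hfl huv hmemM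
    rw [hfφ _ (mem_filter.1 he).2, hfφ _ (hM.iterate_runLength_notMem hH e)]
    exact hl.path e he

end PathSystem

theorem exists_embedding (hM : IsBareSet T M pred succ) (hH : ∀ u v, T.Adj u v → H u < H v)
    (hlong : ∀ x ∈ M, pred x ∈ M ∨ succ x ∈ M) (hE : IsMedianOrder E) {U : Finset ℕ}
    {a p b c w : ℕ} (hU : ∀ y ∈ U, b ≤ y)
    (hhead : ∀ x ∈ M, pred x ∉ M → a ≤ φ (pred x) ∧ φ (pred x) < p)
    (htarget : ∀ x ∈ M, succ x ∉ M → (b ≤ φ (succ x) ∧ φ (succ x) ≤ c) ∧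
      6 * #{y ∈ U | y < φ (succ x)} ≤ φ (succ x) - b + w)
    (hroom : p + #M + 11 * #(runStarts M pred) + (p - a) + w ≤ b) :
    ∃ f : V → ℕ, (∀ x ∉ M, f x = φ x) ∧ Set.InjOn f M ∧
      (∀ x ∈ M, (p ≤ f x ∧ f x < c) ∧ f x ∉ U) ∧
      ∀ u v, T.Adj u v → u ∈ M ∨ v ∈ M → E (f u) (f v) := by
  have htarget' (e : V) (he : e ∈ runStarts M pred) := by
    have hlen := hM.two_le_runLength hH hlong he
    have hmem := iterate_mem_of_lt_runLength (Nat.sub_one_lt (by omega : runLength M succ e ≠ 0))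
    have hsucc : succ (succ^[runLength M succ e - 1] e) = succ^[runLength M succ e] e := by
      rw [← Function.iterate_succ_apply' succ, Nat.succ_eq_add_one, Nat.sub_add_cancel (by omega)]
    exact hsucc ▸ htarget _ hmem (hsucc ▸ hM.iterate_runLength_notMem hH e)
  have hsum : ∑ e ∈ runStarts M pred, (runLength M succ e - 2 + 13) =
      #M + 11 * #(runStarts M pred) := by
    rw [← hM.sum_runLength hH, mul_comm, ← smul_eq_mul, ← sum_const, ← sum_add_distrib]
    refine sum_congr rfl fun e he => ?_
    have := hM.two_le_runLength hH hlong he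
    omega
  obtain ⟨l, hl⟩ := hE.exists_isPathSystem (A := runStarts M pred)
    (h := fun e => φ (pred e)) (g := fun e => φ (succ^[runLength M succ e] e))
    (r := fun e => runLength M succ e - 2) hU
    (fun e he => hhead e (mem_filter.1 he).1 (mem_filter.1 he).2)
    (fun e he => ⟨(htarget' e he).1.1, (htarget' e he).2⟩) (hsum ▸ by omega)
  obtain ⟨f, hfφ, hinj, hX, hadj⟩ := hM.exists_embedding_of_isPathSystem hH hlong hl
  refine ⟨f, hfφ, hinj, fun x hx => ?_, hadj⟩
  obtain ⟨e, he, hfx⟩ := hX x hx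
  rw [mem_sdiff, mem_Ico] at hfx
  exact ⟨⟨hfx.1.1, hfx.1.2.trans_le (htarget' e he).1.2⟩, hfx.2⟩

end Embedding

end IsBareSet

/-! ### Embedding level by level -/

/-- `lv` is constant along each edge of `T`, except that it increases by one on the edges that leave
`L`. A run of `L` thus has the level of the vertex before it, one less than the vertex after it. -/
def IsLeveling {V : Type*} (T : Digraph V) (L : Finset V) (lv : V → ℕ) : Prop :=
  ∀ u v, T.Adj u v → lv v = lv u + if u ∈ L ∧ v ∉ L then 1 else 0

namespace IsLeveling

variable {V : Type*} {T : Digraph V} {L : Finset V} {pred succ : V → V} {lv : V → ℕ}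

theorem apply_pred (hlv : IsLeveling T L lv) (hL : IsBareSet T L pred succ) {x : V} (hx : x ∈ L) :
    lv (pred x) = lv x := by
  have := hlv _ _ (hL.adj_pred hx)
  grind

theorem apply_succ (hlv : IsLeveling T L lv) (hL : IsBareSet T L pred succ) {x : V} (hx : x ∈ L) :
    lv (succ x) = lv x + if succ x ∈ L then 0 else 1 := by
  have := hlv _ _ (hL.adj_succ hx)
  grind

end IsLeveling

/-- The vertices of `L` at level `t`. -/
noncomputable def innerLevel {V : Type*} (L : Finset V) (lv : V → ℕ) (t : ℕ) : Finset V :=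
  {x ∈ L | lv x = t}

theorem mem_innerLevel {V : Type*} {L : Finset V} {lv : V → ℕ} {t : ℕ} {x : V} :
    x ∈ innerLevel L lv t ↔ x ∈ L ∧ lv x = t :=
  mem_filter

theorem IsLeveling.runStarts_innerLevel {V : Type*} {T : Digraph V} {L : Finset V}
    {pred succ : V → V} {lv : V → ℕ} (hlv : IsLeveling T L lv) (hL : IsBareSet T L pred succ)
    (t : ℕ) :
    runStarts (innerLevel L lv t) pred = {x ∈ runStarts L pred | lv x = t} := by
  ext x
  have := hlv.apply_pred hL (x := x)
  grind [runStarts, innerLevel]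

section LevelEmbedding

variable {V : Type*} [Fintype V]

/-- The vertices outside `L` at level `t`. -/
noncomputable def outerLevel (L : Finset V) (lv : V → ℕ) (t : ℕ) : Finset V :=
  {x ∈ Lᶜ | lv x = t}

/-- The position where the block reserved for level `t` starts. If `K` is the outer level, then the
outer vertices use the positions from `4 * #K` to `8 * #K` of the block. The greedy procedure for
the runs starts behind them and needs one position for each vertex in a run, `11` more for each run,
and `4 * #K` to compensate for the positions of the outer vertices, which it passes. -/
noncomputable def blockStart (L : Finset V) (pred : V → V) (lv : V → ℕ) (t : ℕ) : ℕ :=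
  ∑ i ∈ range t, (12 * #(outerLevel L lv i) + #(innerLevel L lv i) +
    11 * #(runStarts (innerLevel L lv i) pred))

/-- `f` embeds `T` in `E` such that the vertices at level `t` are in the block of level `t`, or
among the vertices in `L`, also in the part of the next block that the outer level uses. -/
structure IsLevelEmbedding (E : ℕ → ℕ → Prop) (T : Digraph V) (L : Finset V) (pred : V → V)
    (lv f : V → ℕ) : Prop where
  outer_mem : ∀ x ∉ L,
    blockStart L pred lv (lv x) + 4 * #(outerLevel L lv (lv x)) ≤ f x ∧
      f x < blockStart L pred lv (lv x) + 8 * #(outerLevel L lv (lv x))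
  inner_mem : ∀ x ∈ L,
    blockStart L pred lv (lv x) + 8 * #(outerLevel L lv (lv x)) ≤ f x ∧
      f x < blockStart L pred lv (lv x + 1) + 8 * #(outerLevel L lv (lv x + 1))
  injOn_outer : ∀ t, Set.InjOn f (outerLevel L lv t)
  injOn_inner : ∀ t, Set.InjOn f (innerLevel L lv t)
  ne : ∀ x ∈ L, ∀ y ∉ L, lv y = lv x + 1 → f x ≠ f y
  adj : ∀ u v, T.Adj u v → E (f u) (f v)

theorem mem_outerLevel {L : Finset V} {lv : V → ℕ} {t : ℕ} {x : V} :
    x ∈ outerLevel L lv t ↔ x ∉ L ∧ lv x = t := by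
  rw [outerLevel, mem_filter, mem_compl]

variable {E : ℕ → ℕ → Prop} {T : Digraph V} {L : Finset V} {pred succ : V → V} {H lv : V → ℕ}

theorem blockStart_succ (t : ℕ) :
    blockStart L pred lv (t + 1) = blockStart L pred lv t +
      (12 * #(outerLevel L lv t) + #(innerLevel L lv t) +
        11 * #(runStarts (innerLevel L lv t) pred)) :=
  sum_range_succ _ t

theorem blockStart_le (hlv : IsLeveling T L lv) (hL : IsBareSet T L pred succ) (t : ℕ) :
    blockStart L pred lv t ≤ Fintype.card V + 11 * (#Lᶜ + #(runStarts L pred)) := by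
  have hfiber (S : Finset V) : ∑ i ∈ range t, #{x ∈ S | lv x = i} ≤ #S := by
    rw [sum_card_fiberwise_eq_card_filter]
    exact card_filter_le _ _
  have houter : ∑ i ∈ range t, #(outerLevel L lv i) ≤ #Lᶜ := hfiber _
  have hinner : ∑ i ∈ range t, #(innerLevel L lv i) ≤ #L := hfiber _
  have hstarts : ∑ i ∈ range t, #(runStarts (innerLevel L lv i) pred) ≤ #(runStarts L pred) := by
    simp only [hlv.runStarts_innerLevel hL]
    exact hfiber _
  have := card_add_card_compl L
  rw [blockStart, sum_add_distrib, sum_add_distrib, ← mul_sum, ← mul_sum]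
  omega

theorem blockStart_mono : Monotone (blockStart L pred lv) :=
  monotone_nat_of_le_succ fun t => Nat.le.intro (blockStart_succ t).symm

namespace IsLevelEmbedding

variable {f : V → ℕ}

theorem lt_blockStart (hf : IsLevelEmbedding E T L pred lv f) (x : V) :
    f x < blockStart L pred lv (lv x + 2) := by
  have := blockStart_succ (L := L) (pred := pred) (lv := lv) (lv x)
  have := blockStart_succ (L := L) (pred := pred) (lv := lv) (lv x + 1)
  change f x < blockStart L pred lv (lv x + 1 + 1)
  by_cases hx : x ∈ L
  · have := hf.inner_mem x hx
    omega
  · have := hf.outer_mem x hx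
    omega

theorem injective (hf : IsLevelEmbedding E T L pred lv f) : Function.Injective f := by
  let rank (x : V) : ℕ := lv x + if x ∈ L then 1 else 0
  let top (t : ℕ) : ℕ := blockStart L pred lv t + 8 * #(outerLevel L lv t)
  have hstep (t : ℕ) : top t ≤ blockStart L pred lv (t + 1) := by
    have := blockStart_succ (L := L) (pred := pred) (lv := lv) t
    dsimp only [top]
    omega
  have htop : Monotone top :=
    monotone_nat_of_le_succ fun t => (hstep t).trans (Nat.le_add_right _ _)
  have hrank_inner {x : V} (hx : x ∈ L) : rank x = lv x + 1 := by simp only [rank, if_pos hx]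
  have hrank_outer {x : V} (hx : x ∉ L) : rank x = lv x := by simp only [rank, if_neg hx, add_zero]
  have hupper (x : V) : f x < top (rank x) := by
    by_cases hx : x ∈ L
    · exact hrank_inner hx ▸ (hf.inner_mem x hx).2
    · exact hrank_outer hx ▸ (hf.outer_mem x hx).2
  have hlower (x : V) (t : ℕ) (ht : t < rank x) : top t ≤ f x := by
    by_cases hx : x ∈ L
    · rw [hrank_inner hx] at ht
      exact (htop (Nat.le_of_lt_succ ht)).trans (hf.inner_mem x hx).1
    · rw [hrank_outer hx] at ht
      calc top t ≤ blockStart L pred lv (t + 1) := hstep t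
        _ ≤ blockStart L pred lv (lv x) := blockStart_mono ht
        _ ≤ f x := (Nat.le_add_right _ _).trans (hf.outer_mem x hx).1
  intro x y hxy
  have hxy_rank : rank x = rank y := by
    by_contra hne
    rcases Nat.lt_or_gt_of_ne hne with h | h
    · exact (hupper x).not_ge (hxy ▸ hlower y _ h)
    · exact (hupper y).not_ge (hxy ▸ hlower x _ h)
  by_cases hx : x ∈ L <;> by_cases hy : y ∈ L
  · rw [hrank_inner hx, hrank_inner hy, Nat.add_right_cancel_iff] at hxy_rank
    exact hf.injOn_inner _ (mem_innerLevel.2 ⟨hx, rfl⟩) (mem_innerLevel.2 ⟨hy, hxy_rank.symm⟩) hxy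
  · rw [hrank_inner hx, hrank_outer hy] at hxy_rank
    exact absurd hxy (hf.ne x hx y hy hxy_rank.symm)
  · rw [hrank_outer hx, hrank_inner hy] at hxy_rank
    exact absurd hxy.symm (hf.ne y hy x hx hxy_rank)
  · rw [hrank_outer hx, hrank_outer hy] at hxy_rank
    exact hf.injOn_outer _ (mem_outerLevel.2 ⟨hx, rfl⟩) (mem_outerLevel.2 ⟨hy, hxy_rank.symm⟩) hxy

end IsLevelEmbedding

theorem IsMedianOrder.exists_isSparseEmbedding_outerLevel (hE : IsMedianOrder E)
    (hT : T.IsOrientedGraph) (hacyclic : T.underlying.IsAcyclic) (L : Finset V) (lv : V → ℕ)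
    (B : ℕ → ℕ) : ∃ φ : V → ℕ, ∀ t, IsSparseEmbedding E T (outerLevel L lv t) (B t) φ := by
  choose f hf using fun t => hE.exists_isSparseEmbedding hT hacyclic (outerLevel L lv t) (B t)
  exact ⟨fun x => f (lv x) x, fun t => (hf t).congr fun x hx => by rw [(mem_outerLevel.1 hx).2]⟩

theorem exists_embedding_innerLevel (hE : IsMedianOrder E) (hL : IsBareSet T L pred succ)
    (hH : ∀ u v, T.Adj u v → H u < H v) (hlong : ∀ x ∈ L, pred x ∈ L ∨ succ x ∈ L)
    (hlv : IsLeveling T L lv) {φ : V → ℕ} (hφ : ∀ t, IsSparseEmbedding E T (outerLevel L lv t)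
      (blockStart L pred lv t + 4 * #(outerLevel L lv t)) φ) (t : ℕ) :
    ∃ f : V → ℕ, (∀ x ∉ innerLevel L lv t, f x = φ x) ∧ Set.InjOn f (innerLevel L lv t) ∧
      (∀ x ∈ innerLevel L lv t,
        (blockStart L pred lv t + 8 * #(outerLevel L lv t) ≤ f x ∧
          f x < blockStart L pred lv (t + 1) + 8 * #(outerLevel L lv (t + 1))) ∧
        f x ∉ (outerLevel L lv (t + 1)).image φ) ∧
      ∀ u v, T.Adj u v → u ∈ innerLevel L lv t ∨ v ∈ innerLevel L lv t → E (f u) (f v) := by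
  have hpred (x : V) (hx : x ∈ L) := hlv.apply_pred hL hx
  have hsucc (x : V) (hx : x ∈ L) := hlv.apply_succ hL hx
  have hbare : IsBareSet T (innerLevel L lv t) pred succ := hL.mono (filter_subset _ _)
  refine hbare.exists_embedding hH (fun x hx => ?_) hE
    (a := blockStart L pred lv t + 4 * #(outerLevel L lv t))
    (b := blockStart L pred lv (t + 1) + 4 * #(outerLevel L lv (t + 1)))
    (w := 4 * #(outerLevel L lv (t + 1))) (fun y hy => ?_) (fun x hx hp => ?_)
    (fun x hx hs => ?_) ?_
  · grind [mem_innerLevel]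
  · obtain ⟨x, hx, rfl⟩ := mem_image.1 hy
    exact ((hφ (t + 1)).mem x hx).1
  · have := (hφ t).mem (pred x) (by grind [mem_innerLevel, mem_outerLevel])
    omega
  · have hmem : succ x ∈ outerLevel L lv (t + 1) := by grind [mem_innerLevel, mem_outerLevel]
    have := (hφ (t + 1)).mem _ hmem
    exact ⟨by omega, (hφ (t + 1)).card_image_lt_le hmem⟩
  · have := blockStart_succ (L := L) (pred := pred) (lv := lv) t
    omega

theorem exists_isLevelEmbedding (hE : IsMedianOrder E) (hT : T.IsOrientedTree)
    (hL : IsBareSet T L pred succ) (hH : ∀ u v, T.Adj u v → H u < H v)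
    (hlong : ∀ x ∈ L, pred x ∈ L ∨ succ x ∈ L) (hlv : IsLeveling T L lv) :
    ∃ f, IsLevelEmbedding E T L pred lv f := by
  obtain ⟨φ, hφ⟩ := hE.exists_isSparseEmbedding_outerLevel hT.1 hT.2.isAcyclic L lv
    fun t => blockStart L pred lv t + 4 * #(outerLevel L lv t)
  choose g hgφ hinj hmem hadj using exists_embedding_innerLevel hE hL hH hlong hlv hφ
  have houter (x : V) (hx : x ∉ L) (t : ℕ) : g t x = φ x :=
    hgφ t x fun h => hx (mem_innerLevel.1 h).1
  refine ⟨fun x => g (lv x) x, fun x hx => ?_, fun x hx => ?_, fun t x hx y hy hxy => ?_,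
    fun t x hx y hy hxy => ?_, fun x hx y hy hxy h => ?_, fun u v huv => ?_⟩
  · rw [houter x hx]
    have := (hφ (lv x)).mem x (mem_outerLevel.2 ⟨hx, rfl⟩)
    omega
  · exact (hmem _ x (mem_innerLevel.2 ⟨hx, rfl⟩)).1
  · rw [houter x (mem_outerLevel.1 hx).1, houter y (mem_outerLevel.1 hy).1] at hxy
    exact (hφ t).injOn hx hy hxy
  · rw [(mem_innerLevel.1 hx).2, (mem_innerLevel.1 hy).2] at hxy
    exact hinj t hx hy hxy
  · refine (hmem _ x (mem_innerLevel.2 ⟨hx, rfl⟩)).2 ?_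
    rw [h, houter y hy]
    exact mem_image_of_mem _ (mem_outerLevel.2 ⟨hy, hxy⟩)
  · have hlevel := hlv u v huv
    by_cases hu : u ∈ L
    · have h := hadj (lv u) u v huv (.inl (mem_innerLevel.2 ⟨hu, rfl⟩))
      by_cases hv : v ∈ L <;> grind
    by_cases hv : v ∈ L
    · have h := hadj (lv v) u v huv (.inr (mem_innerLevel.2 ⟨hv, rfl⟩))
      grind
    · rw [houter u hu, houter v hv]
      exact (hφ (lv u)).adj u (mem_outerLevel.2 ⟨hu, rfl⟩) v (mem_outerLevel.2 (by grind)) huv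

end LevelEmbedding

/-! ### Counting runs -/

/-- The vertices of `D` that are in runs of length at least two. -/
noncomputable def longRuns {V : Type*} (D : Finset V) (pred succ : V → V) : Finset V :=
  {x ∈ D | pred x ∈ D ∨ succ x ∈ D}

theorem longRuns_subset {V : Type*} (D : Finset V) (pred succ : V → V) :
    longRuns D pred succ ⊆ D :=
  filter_subset _ _

theorem IsBareSet.pred_mem_or_succ_mem_longRuns {V : Type*} {T : Digraph V} {D : Finset V}
    {pred succ : V → V} (hD : IsBareSet T D pred succ) {x : V} (hx : x ∈ longRuns D pred succ) :
    pred x ∈ longRuns D pred succ ∨ succ x ∈ longRuns D pred succ := by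
  obtain ⟨hxD, hpred | hsucc⟩ := mem_filter.1 hx
  · exact .inl (mem_filter.2 ⟨hpred, .inr ((hD.succ_pred hxD hpred).symm ▸ hxD)⟩)
  · exact .inr (mem_filter.2 ⟨hsucc, .inl ((hD.pred_succ hxD hsucc).symm ▸ hxD)⟩)

section Counting

variable {V : Type*} [Fintype V] {T : Digraph V}

theorem card_degree_ne_two_add_two_le [Nontrivial V] (hT : T.underlying.IsTree) :
    #{x | T.underlyingDegree x ≠ 2} + 2 ≤ 2 * T.leaves.ncard := by
  have hdegree (x : V) : T.underlyingDegree x = T.underlying.degree x := by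
    rw [Digraph.underlyingDegree, Set.ncard_eq_toFinset_card']
    rfl
  have hleaves : T.leaves.ncard = #{x | T.underlyingDegree x = 1} := by
    rw [← Set.ncard_coe_finset, coe_filter_univ]
    rfl
  have hsum : ∑ x : V, (2 + if T.underlyingDegree x ≠ 2 then 1 else 0) ≤
      ∑ x : V, (T.underlying.degree x + 2 * if T.underlyingDegree x = 1 then 1 else 0) := by
    refine sum_le_sum fun x _ => ?_
    have := hT.connected.preconnected.degree_pos_of_nontrivial x
    rw [hdegree]
    split_ifs <;> omega
  rw [sum_add_distrib, sum_add_distrib, ← mul_sum, ← card_filter, ← card_filter,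
    T.underlying.sum_degrees_eq_twice_card_edges, sum_const, smul_eq_mul, card_univ,
    ← hleaves] at hsum
  have := hT.card_edgeFinset
  omega

namespace IsBareSet

variable {D : Finset V} {pred succ : V → V}

theorem card_add_card_runStarts_lt (hD : IsBareSet T D pred succ) (hT : T.IsOrientedTree) :
    #D + #(runStarts D pred) < Fintype.card V := by
  refine lt_of_le_of_lt ?_ (card_adj_lt hT)
  rw [← card_image_of_injective D (f := fun x => (x, succ x)) fun a b h => (Prod.mk.inj h).1,
    ← card_image_of_injective (f := fun x => (pred x, x)) _ fun a b h => (Prod.mk.inj h).2,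
    ← card_union_of_disjoint]
  · refine card_le_card (union_subset ?_ ?_) <;> refine image_subset_iff.2 fun x hx => ?_
    · exact mem_filter.2 ⟨mem_univ _, hD.adj_succ hx⟩
    · exact mem_filter.2 ⟨mem_univ _, hD.adj_pred (mem_filter.1 hx).1⟩
  · grind [disjoint_left, runStarts]

theorem card_compl_longRuns_add_card_runStarts_le (hD : IsBareSet T D pred succ) :
    #(longRuns D pred succ)ᶜ + #(runStarts (longRuns D pred succ) pred) ≤
      #Dᶜ + #(runStarts D pred) := by
  have hsub : runStarts (longRuns D pred succ) pred ⊆ runStarts D pred := fun x hx => by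
    obtain ⟨hxL, hpred⟩ := mem_filter.1 hx
    have hxD := (mem_filter.1 hxL).1
    exact mem_filter.2 ⟨hxD, fun hpD =>
      hpred (mem_filter.2 ⟨hpD, .inr ((hD.succ_pred hxD hpD).symm ▸ hxD)⟩)⟩
  have hsingle : D \ longRuns D pred succ ⊆
      runStarts D pred \ runStarts (longRuns D pred succ) pred := by
    grind [longRuns, runStarts]
  have hcard := card_le_card hsingle
  rw [card_sdiff_of_subset hsub, card_sdiff_of_subset (longRuns_subset D pred succ)] at hcard
  have := card_le_card hsub
  have := card_le_card (longRuns_subset D pred succ)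
  have := card_add_card_compl D
  have := card_add_card_compl (longRuns D pred succ)
  omega

end IsBareSet

end Counting

theorem exists_pred_succ {V : Type*} {T : Digraph V} (hT : T.IsOrientedGraph)
    (hbare : ∀ (u w : V) (p : T.underlying.Walk u w), T.IsBarePath p → T.IsDirectedPath p)
    {x : V} (hx : T.underlyingDegree x = 2) :
    ∃ a b, (∀ y, T.Adj y x ↔ y = a) ∧ ∀ y, T.Adj x y ↔ y = b := by
  obtain ⟨a, b, hab, hN⟩ := Set.ncard_eq_two.1 hx
  have hnbr (y : V) : T.Adj x y ∨ T.Adj y x ↔ y = a ∨ y = b := by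
    rw [← underlying_adj hT, ← SimpleGraph.mem_neighborSet, hN]
    rfl
  have ha : T.underlying.Adj a x := ((underlying_adj hT).2 ((hnbr a).2 (.inl rfl))).symm
  have hb : T.underlying.Adj x b := (underlying_adj hT).2 ((hnbr b).2 (.inr rfl))
  have hpath : T.IsBarePath (.cons ha (.cons hb .nil)) :=
    ⟨by simp [SimpleGraph.Walk.isPath_def, ha.ne, hb.ne, hab],
      fun y hy hya hyb => by simp_all⟩
  rcases (hbare _ _ _ hpath).2 with h | h
  · have hax : T.Adj a x := h ⟨(a, x), ha⟩ (by simp)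
    have hxb : T.Adj x b := h ⟨(x, b), hb⟩ (by simp)
    exact ⟨a, b, by grind [hT _ _ hax, hT _ _ hxb], by grind [hT _ _ hax, hT _ _ hxb]⟩
  · have hxa : T.Adj x a := h ⟨(a, x), ha⟩ (by simp)
    have hbx : T.Adj b x := h ⟨(x, b), hb⟩ (by simp)
    exact ⟨b, a, by grind [hT _ _ hxa, hT _ _ hbx], by grind [hT _ _ hxa, hT _ _ hbx]⟩

theorem exists_isBareSet_degree_eq_two {V : Type*} [Fintype V] {T : Digraph V}
    (hT : T.IsOrientedGraph)
    (hbare : ∀ (u w : V) (p : T.underlying.Walk u w), T.IsBarePath p → T.IsDirectedPath p) :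
    ∃ pred succ : V → V, IsBareSet T ({x | T.underlyingDegree x = 2} : Finset V) pred succ := by
  have h (x : V) : ∃ a b, x ∈ ({x | T.underlyingDegree x = 2} : Finset V) →
      (∀ y, T.Adj y x ↔ y = a) ∧ ∀ y, T.Adj x y ↔ y = b := by
    by_cases hx : T.underlyingDegree x = 2
    · obtain ⟨a, b, hab⟩ := exists_pred_succ hT hbare hx
      exact ⟨a, b, fun _ => hab⟩
    · exact ⟨x, x, fun hx' => absurd (mem_filter.1 hx').2 hx⟩
  choose pred succ h using h
  exact ⟨pred, succ, fun x hx => (h x hx).1, fun x hx => (h x hx).2⟩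

theorem IsMedianOrder.exists_embedding {V : Type*} [Fintype V] {E : ℕ → ℕ → Prop}
    (hE : IsMedianOrder E) {T : Digraph V} (hT : T.IsOrientedTree) {L : Finset V}
    {pred succ : V → V} (hL : IsBareSet T L pred succ)
    (hlong : ∀ x ∈ L, pred x ∈ L ∨ succ x ∈ L) :
    ∃ f : V → ℕ, Function.Injective f ∧
      (∀ x, f x < Fintype.card V + 11 * (#Lᶜ + #(runStarts L pred))) ∧
      ∀ u v, T.Adj u v → E (f u) (f v) := by
  obtain ⟨height, hheight⟩ := exists_potential hT fun _ _ => 1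
  obtain ⟨lv, hlv⟩ : ∃ lv, IsLeveling T L lv :=
    exists_potential hT fun u v => if u ∈ L ∧ v ∉ L then 1 else 0
  have hmono (u v : V) (huv : T.Adj u v) : height u < height v :=
    (Nat.lt_add_one _).trans_eq (hheight u v huv).symm
  obtain ⟨f, hf⟩ := exists_isLevelEmbedding hE hT hL hmono hlong hlv
  exact ⟨f, hf.injective, fun x => (hf.lt_blockStart x).trans_le (blockStart_le hlv hL _), hf.adj⟩

theorem IsMedianOrder.exists_embedding_of_isBarePath {V : Type*} [Fintype V] [Nontrivial V]
    {E : ℕ → ℕ → Prop} (hE : IsMedianOrder E) {T : Digraph V} (hT : T.IsOrientedTree)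
    (hbare : ∀ (u w : V) (p : T.underlying.Walk u w), T.IsBarePath p → T.IsDirectedPath p) :
    ∃ f : V → ℕ, Function.Injective f ∧ (∀ x, f x < Fintype.card V + 44 * T.leaves.ncard) ∧
      ∀ u v, T.Adj u v → E (f u) (f v) := by
  obtain ⟨pred, succ, hD⟩ := exists_isBareSet_degree_eq_two hT.1 hbare
  obtain ⟨f, hf, hlt, hadj⟩ := hE.exists_embedding hT (hD.mono (longRuns_subset _ _ _))
    fun x => hD.pred_mem_or_succ_mem_longRuns
  refine ⟨f, hf, fun x => (hlt x).trans_le ?_, hadj⟩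
  have hlong := hD.card_compl_longRuns_add_card_runStarts_le
  have hruns := hD.card_add_card_runStarts_lt hT
  have hcompl := card_add_card_compl ({x | T.underlyingDegree x = 2} : Finset V)
  have hdegree := card_degree_ne_two_add_two_le hT.2
  rw [← compl_filter] at hdegree
  omega

theorem theorem3p1_general {V W : Type*} [Finite V] (T : Digraph V) (hT : T.IsOrientedTree)
    (hbare : ∀ (u w : V) (p : T.underlying.Walk u w), T.IsBarePath p → T.IsDirectedPath p)
    (G : Digraph W) (hG : ∀ u v, u ≠ v → G.Adj u v ∨ G.Adj v u)
    (hcard : Nat.card V + 44 * T.leaves.ncard ≤ Nat.card W) : G.ContainsCopy T := by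
  have := Fintype.ofFinite V
  have hV : 0 < Nat.card V := Nat.card_pos_iff.2 ⟨hT.2.connected.nonempty, inferInstance⟩
  have hW : 0 < Nat.card W := by omega
  have : Finite W := Nat.finite_of_card_ne_zero hW.ne'
  rcases subsingleton_or_nontrivial V with hV | hV
  · obtain ⟨w⟩ := (Nat.card_pos_iff.1 hW).1
    exact ⟨fun _ => w, Function.injective_of_subsingleton _, fun u v huv =>
      absurd (Subsingleton.elim u v ▸ huv) (hT.1 u v huv)⟩
  obtain ⟨E, hE, e, he⟩ := exists_isMedianOrder hG
  obtain ⟨f, hf, hlt, hadj⟩ := hE.exists_embedding_of_isBarePath hT hbare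
  rw [← Nat.card_eq_fintype_card] at hlt
  have hlt (x : V) : f x < Nat.card W := (hlt x).trans_le hcard
  exact ⟨fun x => e ⟨f x, hlt x⟩, fun x y hxy => hf (Fin.mk.inj_iff.1 (e.injective hxy)),
    fun u v huv => he _ _ (hadj u v huv)⟩

theorem theorem3p1 {V W : Type*} [Finite V] [Finite W] (n k : ℕ)
    (T : Digraph V) (hT : T.IsOrientedTree) (hn : Nat.card V = n) (hk : T.leaves.ncard = k)
    (hbare : ∀ (u w : V) (p : T.underlying.Walk u w), T.IsBarePath p → T.IsDirectedPath p)
    (G : Digraph W) (hG : G.IsTournament) (hcard : Nat.card W = n + 50 * k) :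
    G.ContainsCopy T :=
  theorem3p1_general T hT hbare G (fun u v huv => by grind [hG.2 u v huv]) (by omega)
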